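/- Let $\gamma\ge 1$ be an integer, let $\Omega\subset\mathbb R^2$ be a bounded open set with Lipschitz boundary (near each boundary point, in suitable Cartesian coordinates, $\Omega$ is the set of points strictly above the graph of a Lipschitz function), and let $2/\gamma<q<\infty$. Let $H^\gamma(\Omega)$ be the Hilbert space obtained as the closure of $C^\infty(\overline\Omega,\mathbb C)$ (restrictions to $\overline\Omega$ of smooth functions on $\mathbb R^2$) under the norm $$\|u\|_{H^\gamma(\Omega)}^2=\sum_{j=0}^{\gamma}\|\nabla^{\otimes j}u\|_{L^2(\Omega)}^2 .$$ Then the embedding $\iota\colon H^\gamma(\Omega)\to L^2(\Omega)$ is in the $q$-Schatten class; that is, $\iota$ is compact and $\sum_{n\ge 1}s_n(\iota)^q<\infty$, where $(s_n(\iota))_{n\ge1}$ is the decreasing sequence of singular values of $\iota$ counted with multiplicity. -/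

import Mathlib

open MeasureTheory
open scoped ContDiff

/-! ### Schatten classes -/

/-- The singular values of a bounded operator `S` between Hilbert spaces, in decreasing order and
counted with multiplicity: for compact `S`, `singularValue S n` is the `(n+1)`-st largest one, that
is, the largest `σ > 0` such that the eigenspaces of `S† S` for the eigenvalues `τ ^ 2` with
`τ ≥ σ` span a space of dimension at least `n + 1`. It is `0` (the supremum of the empty set) if
`S` has at most `n` nonzero singular values. -/
noncomputable def singularValue {H₁ H₂ : Type*}
    [NormedAddCommGroup H₁] [InnerProductSpace ℂ H₁] [CompleteSpace H₁]
    [NormedAddCommGroup H₂] [InnerProductSpace ℂ H₂] [CompleteSpace H₂]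
    (S : H₁ →L[ℂ] H₂) (n : ℕ) : ℝ :=
  sSup {σ : ℝ | 0 < σ ∧ ((n + 1 : ℕ) : Cardinal) ≤
    Module.rank ℂ (⨆ (τ : ℝ) (_ : σ ≤ τ),
      Module.End.eigenspace ((ContinuousLinearMap.adjoint S ∘L S : H₁ →L[ℂ] H₁) : H₁ →ₗ[ℂ] H₁)
        ((τ ^ 2 : ℝ) : ℂ) : Submodule ℂ H₁)}

/-- The `q`-Schatten (quasi-)norm `(∑ₙ sₙ(S) ^ q) ^ (1 / q)`, possibly `∞`. -/
noncomputable def schattenNorm {H₁ H₂ : Type*}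
    [NormedAddCommGroup H₁] [InnerProductSpace ℂ H₁] [CompleteSpace H₁]
    [NormedAddCommGroup H₂] [InnerProductSpace ℂ H₂] [CompleteSpace H₂]
    (q : ℝ) (S : H₁ →L[ℂ] H₂) : ENNReal :=
  (∑' n : ℕ, ENNReal.ofReal (singularValue S n) ^ q) ^ (1 / q)

/-- The `q`-Schatten class: compact operators with finite `q`-Schatten (quasi-)norm. -/
def IsSchattenClass {H₁ H₂ : Type*}
    [NormedAddCommGroup H₁] [InnerProductSpace ℂ H₁] [CompleteSpace H₁]
    [NormedAddCommGroup H₂] [InnerProductSpace ℂ H₂] [CompleteSpace H₂]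
    (q : ℝ) (S : H₁ →L[ℂ] H₂) : Prop :=
  IsCompactOperator S ∧ schattenNorm q S < ⊤

/-! ### Lipschitz boundary -/

/-- `Ω ⊆ ℝ²` has Lipschitz boundary: near each boundary point, in suitable Cartesian coordinates
(given by the linear isometry `e`), `Ω` is the region strictly above the graph of a Lipschitz
function. -/
def HasLipschitzBoundary (Ω : Set (EuclideanSpace ℝ (Fin 2))) : Prop :=
  ∀ x ∈ frontier Ω, ∃ (e : EuclideanSpace ℝ (Fin 2) ≃ₗᵢ[ℝ] EuclideanSpace ℝ (Fin 2)) (g : ℝ → ℝ)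
    (K : NNReal) (r : ℝ), LipschitzWith K g ∧ 0 < r ∧
      ∀ y ∈ Metric.ball x r, y ∈ Ω ↔ g (e y 0) < e y 1

/-! ### The Sobolev space `H^γ(Ω)` -/

/-- The iterated partial derivative `∂_{κ 0} ⋯ ∂_{κ (j-1)} u`; these are the components of the
tensor `∇^{⊗ j} u`. -/
noncomputable def partialDeriv {j : ℕ} (κ : Fin j → Fin 2) (u : EuclideanSpace ℝ (Fin 2) → ℂ)
    (x : EuclideanSpace ℝ (Fin 2)) : ℂ :=
  iteratedFDeriv ℝ j u x (fun i => EuclideanSpace.single (κ i) (1 : ℝ))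

/-- Indices of the components of `(u, ∇ u, …, ∇^{⊗ γ} u)`. -/
abbrev JetIndex (γ : ℕ) : Type := Σ j : Fin (γ + 1), (Fin (j : ℕ) → Fin 2)

/-- The Hilbert sum of one copy of `L²(Ω, ℂ)` for each component of `(u, ∇ u, …, ∇^{⊗ γ} u)`. -/
abbrev JetSpace (γ : ℕ) (Ω : Set (EuclideanSpace ℝ (Fin 2))) : Type :=
  PiLp 2 (fun _ : JetIndex γ => Lp ℂ 2 (volume.restrict Ω))

lemma partialDeriv_add {j : ℕ} (κ : Fin j → Fin 2) {u v : EuclideanSpace ℝ (Fin 2) → ℂ}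
    (hu : ContDiff ℝ ∞ u) (hv : ContDiff ℝ ∞ v) (x : EuclideanSpace ℝ (Fin 2)) :
    partialDeriv κ (u + v) x = partialDeriv κ u x + partialDeriv κ v x := by
  unfold partialDeriv
  rw [iteratedFDeriv_add_apply
    (hu.contDiffAt.of_le (by exact_mod_cast le_top))
    (hv.contDiffAt.of_le (by exact_mod_cast le_top))]
  rfl

lemma partialDeriv_const_smul {j : ℕ} (κ : Fin j → Fin 2) {u : EuclideanSpace ℝ (Fin 2) → ℂ}
    (c : ℂ) (hu : ContDiff ℝ ∞ u) (x : EuclideanSpace ℝ (Fin 2)) :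
    partialDeriv κ (c • u) x = c • partialDeriv κ u x := by
  unfold partialDeriv
  rw [iteratedFDeriv_const_smul_apply
    (hu.contDiffAt.of_le (by exact_mod_cast le_top))]
  rfl

/-- The jets `(u, ∇ u, …, ∇^{⊗ γ} u)` on `Ω` of the functions `u ∈ C^∞(closure Ω)`, i.e. of the
restrictions to `closure Ω` of smooth functions on `ℝ²`, whose derivatives of order at most `γ` are
in `L²(Ω)` (which is automatic if `Ω` is bounded). -/
noncomputable def smoothJets (γ : ℕ) (Ω : Set (EuclideanSpace ℝ (Fin 2))) :
    Submodule ℂ (JetSpace γ Ω) where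
  carrier := {U | ∃ u : EuclideanSpace ℝ (Fin 2) → ℂ, ContDiff ℝ ∞ u ∧
    ∀ k : JetIndex γ, U k =ᵐ[volume.restrict Ω] partialDeriv k.2 u}
  zero_mem' := by
    refine ⟨0, contDiff_const, fun k => ?_⟩
    filter_upwards [Lp.coeFn_zero ℂ 2 (volume.restrict Ω)] with x hx
    have h0 : partialDeriv k.2 (0 : EuclideanSpace ℝ (Fin 2) → ℂ) x = 0 := by
      simpa using partialDeriv_const_smul k.2 (u := 0) (0 : ℂ) contDiff_const x
    rw [h0]
    exact hx
  add_mem' := by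
    rintro U V ⟨u, hu, hU⟩ ⟨v, hv, hV⟩
    refine ⟨u + v, hu.add hv, fun k => ?_⟩
    filter_upwards [hU k, hV k, Lp.coeFn_add (U k) (V k)] with x h1 h2 h3
    rw [partialDeriv_add k.2 hu hv, ← h1, ← h2]
    exact h3
  smul_mem' := by
    rintro c U ⟨u, hu, hU⟩
    refine ⟨c • u, contDiff_const.smul hu, fun k => ?_⟩
    filter_upwards [hU k, Lp.coeFn_smul c (U k)] with x h1 h3
    rw [partialDeriv_const_smul k.2 c hu, ← h1]
    exact h3

/-- `H^γ(Ω)`: the closure of `C^∞(closure Ω)` under the norm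
`‖u‖² = ∑_{0 ≤ j ≤ γ} ‖∇^{⊗ j} u‖²_{L²(Ω)}`. A function is represented by
`(u, ∇ u, …, ∇^{⊗ γ} u)`, so that the norm becomes the one of `JetSpace γ Ω`; `u` determines the
other components if `Ω` is open, see `sobolevEmbedding_injective`. -/
abbrev SobolevSpace (γ : ℕ) (Ω : Set (EuclideanSpace ℝ (Fin 2))) : Type :=
  (smoothJets γ Ω).topologicalClosure

/-- The embedding `H^γ(Ω) → L²(Ω)`, `u ↦ u`. -/
noncomputable def sobolevEmbedding (γ : ℕ) (Ω : Set (EuclideanSpace ℝ (Fin 2))) :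
    SobolevSpace γ Ω →L[ℂ] Lp ℂ 2 (volume.restrict Ω) :=
  (PiLp.proj (𝕜 := ℂ) 2 (fun _ : JetIndex γ => Lp ℂ 2 (volume.restrict Ω))
    (⟨0, fun _ => 0⟩ : JetIndex γ)) ∘L (smoothJets γ Ω).topologicalClosure.subtypeL

/-- The components of an element of `H^γ(Ω)` are weak derivatives of each other. -/
lemma integral_smul_succ_eq_neg {γ : ℕ} {Ω : Set (EuclideanSpace ℝ (Fin 2))}
    (U : SobolevSpace γ Ω) {j : ℕ} (hj : j + 1 < γ + 1) (κ : Fin (j + 1) → Fin 2)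
    (φ : EuclideanSpace ℝ (Fin 2) → ℝ) (hφ : ContDiff ℝ ∞ φ) (hc : HasCompactSupport φ)
    (hs : tsupport φ ⊆ Ω) :
    ∫ x in Ω, φ x • (U : JetSpace γ Ω) ⟨⟨j + 1, hj⟩, κ⟩ x =
      -∫ x in Ω, fderiv ℝ φ x (EuclideanSpace.single (κ 0) 1) •
        (U : JetSpace γ Ω) ⟨⟨j, (Nat.lt_succ_self j).trans hj⟩, Fin.tail κ⟩ x := by
  have key : ∀ ψ : EuclideanSpace ℝ (Fin 2) → ℝ, Continuous ψ → HasCompactSupport ψ →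
      ∃ L : Lp ℂ 2 (volume.restrict Ω) →L[ℂ] ℂ, ∀ v, L v = ∫ x in Ω, ψ x • v x := by
    intro ψ h1 h2
    have hm : MemLp (fun x => (ψ x : ℂ)) 2 (volume.restrict Ω) :=
      ((Complex.continuous_ofReal.comp h1).memLp_of_hasCompactSupport
        (h2.comp_left (g := fun t : ℝ => (t : ℂ)) Complex.ofReal_zero))
    refine ⟨innerSL ℂ hm.toLp, fun v => ?_⟩
    rw [innerSL_apply_apply, L2.inner_def]
    refine integral_congr_ae ?_
    filter_upwards [hm.coeFn_toLp] with x hx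
    rw [hx]
    simp [mul_comm]
  have hφ1 : Continuous fun x => fderiv ℝ φ x (EuclideanSpace.single (κ 0) 1) :=
    (hφ.continuous_fderiv (by simp)).clm_apply continuous_const
  have hφ2 : HasCompactSupport fun x => fderiv ℝ φ x (EuclideanSpace.single (κ 0) 1) :=
    hc.fderiv_apply (𝕜 := ℝ) _
  obtain ⟨L₁, hL₁⟩ := key φ hφ.continuous hc
  obtain ⟨L₂, hL₂⟩ := key _ hφ1 hφ2
  rw [← hL₁, ← hL₂]
  have hcl : IsClosed {V : JetSpace γ Ω | L₁ (V ⟨⟨j + 1, hj⟩, κ⟩) =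
      -L₂ (V ⟨⟨j, (Nat.lt_succ_self j).trans hj⟩, Fin.tail κ⟩)} :=
    isClosed_eq (by fun_prop) (by fun_prop)
  refine closure_minimal (s := (smoothJets γ Ω : Set (JetSpace γ Ω))) ?_ hcl U.2
  rintro V ⟨u, hu, hV⟩
  change L₁ _ = -L₂ _
  rw [hL₁, hL₂]
  have e1 : ∫ x in Ω, φ x • V ⟨⟨j + 1, hj⟩, κ⟩ x = ∫ x, φ x • partialDeriv κ u x := by
    rw [← setIntegral_eq_integral_of_forall_compl_eq_zero (s := Ω)
      (f := fun x => φ x • partialDeriv κ u x)]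
    · refine integral_congr_ae ?_
      filter_upwards [hV ⟨⟨j + 1, hj⟩, κ⟩] with x hx
      rw [hx]
    · intro x hx
      rw [image_eq_zero_of_notMem_tsupport (fun h => hx (hs h)), zero_smul]
  have e2 : ∫ x in Ω, fderiv ℝ φ x (EuclideanSpace.single (κ 0) 1) •
        V ⟨⟨j, (Nat.lt_succ_self j).trans hj⟩, Fin.tail κ⟩ x =
      ∫ x, fderiv ℝ φ x (EuclideanSpace.single (κ 0) 1) • partialDeriv (Fin.tail κ) u x := by
    rw [← setIntegral_eq_integral_of_forall_compl_eq_zero (s := Ω)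
      (f := fun x => fderiv ℝ φ x (EuclideanSpace.single (κ 0) 1) •
        partialDeriv (Fin.tail κ) u x)]
    · refine integral_congr_ae ?_
      filter_upwards [hV ⟨⟨j, (Nat.lt_succ_self j).trans hj⟩, Fin.tail κ⟩] with x hx
      rw [hx]
    · intro x hx
      have : fderiv ℝ φ x = 0 := image_eq_zero_of_notMem_tsupport
        (fun h => hx (hs (tsupport_fderiv_subset ℝ h)))
      simp [this]
  rw [e1, e2]
  have hd : Differentiable ℝ (iteratedFDeriv ℝ j u) :=
    hu.differentiable_iteratedFDeriv (by exact_mod_cast WithTop.coe_lt_top j)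
  have hp : Differentiable ℝ (partialDeriv (Fin.tail κ) u) := by
    intro x
    exact ((ContinuousMultilinearMap.apply ℝ _ ℂ _).differentiableAt).comp x (hd x)
  have hpc : Continuous fun x => partialDeriv κ u x := by
    exact (ContinuousMultilinearMap.apply ℝ (fun _ : Fin (j + 1) => EuclideanSpace ℝ (Fin 2)) ℂ
      (fun i => EuclideanSpace.single (κ i) (1 : ℝ))).continuous.comp
      (hu.continuous_iteratedFDeriv (m := j + 1) (by exact_mod_cast le_top))
  have hf : ∀ x, fderiv ℝ (partialDeriv (Fin.tail κ) u) x (EuclideanSpace.single (κ 0) 1) =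
      partialDeriv κ u x := by
    intro x
    have h1 : HasFDerivAt (partialDeriv (Fin.tail κ) u) _ x :=
      ((ContinuousMultilinearMap.apply ℝ (fun _ : Fin j => EuclideanSpace ℝ (Fin 2)) ℂ
        (fun i => EuclideanSpace.single (Fin.tail κ i) (1 : ℝ))).hasFDerivAt).comp x
        (hd x).hasFDerivAt
    rw [h1.fderiv]
    rfl
  simp only [← hf]
  refine integral_smul_fderiv_eq_neg_fderiv_smul_of_integrable ?_ ?_ ?_ ?_ ?_
  · exact (hφ1.smul hp.continuous).integrable_of_hasCompactSupport hφ2.smul_right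
  · simp only [hf]
    exact (hφ.continuous.smul hpc).integrable_of_hasCompactSupport hc.smul_right
  · exact (hφ.continuous.smul hp.continuous).integrable_of_hasCompactSupport hc.smul_right
  · exact fun x _ => (hφ.differentiable (by simp)) x
  · exact fun x _ => hp x

/-- An element of `H^γ(Ω)` is determined by its underlying `L²` function. -/
lemma sobolevEmbedding_injective (γ : ℕ) {Ω : Set (EuclideanSpace ℝ (Fin 2))} (hΩ : IsOpen Ω) :
    Function.Injective (sobolevEmbedding γ Ω) := by
  rw [injective_iff_map_eq_zero]
  intro U hU
  have main : ∀ (j : ℕ) (hj : j < γ + 1) (κ : Fin j → Fin 2),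
      (U : JetSpace γ Ω) ⟨⟨j, hj⟩, κ⟩ = 0 := by
    intro j
    induction j with
    | zero =>
      intro hj κ
      rw [Subsingleton.elim κ (fun _ => 0)]
      exact hU
    | succ j ih =>
      intro hj κ
      rw [Lp.eq_zero_iff_ae_eq_zero, Filter.EventuallyEq,
        ae_restrict_iff' hΩ.measurableSet]
      refine hΩ.ae_eq_zero_of_integral_contDiff_smul_eq_zero ?_ ?_
      · refine locallyIntegrableOn_of_locallyIntegrable_restrict ?_
        exact (Lp.memLp _).locallyIntegrable (by norm_num)
      · intro φ hφ hc hs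
        rw [← setIntegral_eq_integral_of_forall_compl_eq_zero (s := Ω),
          integral_smul_succ_eq_neg U hj κ φ hφ hc hs, ih, neg_eq_zero]
        · refine integral_eq_zero_of_ae ?_
          filter_upwards [Lp.coeFn_zero ℂ 2 (volume.restrict Ω)] with x hx
          rw [hx]
          simp
        · intro x hx
          rw [image_eq_zero_of_notMem_tsupport (fun h => hx (hs h)), zero_smul]
  ext1
  ext1 k
  exact main k.1 k.1.2 k.2

/-! ### A criterion for Schatten classes -/

section Schatten

variable {H₁ H₂ : Type*}
  [NormedAddCommGroup H₁] [InnerProductSpace ℂ H₁] [CompleteSpace H₁]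
  [NormedAddCommGroup H₂] [InnerProductSpace ℂ H₂] [CompleteSpace H₂]

/-! The proof rests on the min–max principle. If `‖S u‖ ≤ ε ‖u‖` on the common kernel of `n`
functionals, then `sₙ(S) ≤ ε`: a space of dimension `n + 1` on which `S` is bounded below by `σ`
meets that kernel nontrivially, so `σ ≤ ε` (`singularValue_le_of_functionals`). It therefore
suffices to find, for each small `h`, a family of `O(h⁻²)` functionals on whose common kernel the
`L²` norm is at most `(C h)^γ` times the `H^γ` norm. Taking `h` of order `n^(-1/2)` gives `sₙ =
O(n^(-γ/2))`, and `n^(-γ/2)` is `q`-summable exactly for `q > 2/γ`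
(`isSchattenClass_of_functionals`).

The functionals are integrals of the derivatives of `u` over small sets. Near a boundary point, the
region above the Lipschitz graph is cut into cells of diameter `O(h)` fitted to the graph. Each cell
is star-shaped with respect to a core of comparable area, so the Poincaré inequality holds on it
with constant `O(h)` up to the integral over the core (`lintegral_sq_le_of_starShaped`,
`lintegral_graphCell_sq_le`). The cells used lie inside `Ω`, so no extension operator is needed, and
compactness of the closure patches the local estimates together
(`HasLipschitzBoundary.hasPoincareCells`).

When all these integrals vanish, the inequality applies in turn to the derivatives of orders `0, …,
γ - 1`. Each application gains a factor `O(h)`, which yields `h^γ` (`norm_jet_zero_sq_le`). The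
estimate passes from smooth functions to `H^γ` because both sides are continuous
(`enorm_jet_sq_le`). -/

lemma singularValue_nonneg (S : H₁ →L[ℂ] H₂) (n : ℕ) : 0 ≤ singularValue S n :=
  Real.sSup_nonneg fun _ hσ => hσ.1.le

/-- `S` is bounded below by `σ` on the span of the eigenspaces of `S† S` for eigenvalues
`τ ^ 2` with `τ ≥ σ`. -/
lemma mul_norm_le_norm_of_mem_iSup_eigenspace (S : H₁ →L[ℂ] H₂) {σ : ℝ} (hσ : 0 < σ) {w : H₁}
    (hw : w ∈ (⨆ (τ : ℝ) (_ : σ ≤ τ),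
      Module.End.eigenspace ((ContinuousLinearMap.adjoint S ∘L S : H₁ →L[ℂ] H₁) : H₁ →ₗ[ℂ] H₁)
        ((τ ^ 2 : ℝ) : ℂ) : Submodule ℂ H₁)) :
    σ * ‖w‖ ≤ ‖S w‖ := by
  set T : H₁ →L[ℂ] H₁ := ContinuousLinearMap.adjoint S ∘L S with hT
  have hsymm : (T : H₁ →ₗ[ℂ] H₁).IsSymmetric := by
    intro x y
    simp [hT, ContinuousLinearMap.adjoint_inner_left, ContinuousLinearMap.adjoint_inner_right]
  rw [iSup_subtype'] at hw
  -- Distinct `τ ≥ σ > 0` have distinct squares, so these eigenspaces are pairwise orthogonal.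
  have horth := hsymm.orthogonalFamily_eigenspaces.comp
    (γ := {τ : ℝ // σ ≤ τ}) (f := fun τ => (((τ : ℝ) ^ 2 : ℝ) : ℂ)) (by
      intro a b hab
      have h1 : (a : ℝ) ^ 2 = (b : ℝ) ^ 2 := Complex.ofReal_injective hab
      have ha : 0 ≤ (a : ℝ) := hσ.le.trans a.2
      have hb : 0 ≤ (b : ℝ) := hσ.le.trans b.2
      exact Subtype.ext ((sq_eq_sq₀ ha hb).1 h1))
  classical
  obtain ⟨f, hf⟩ := (Submodule.mem_iSup_iff_exists_dfinsupp' _ w).1 hw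
  have hw' : ∑ i ∈ f.support, ((f i : H₁)) = w := by
    rw [← hf, DFinsupp.sum]
  have hTw : T w = ∑ i ∈ f.support,
      (((((i : ℝ) ^ 2 : ℝ) : ℂ) • f i : Module.End.eigenspace (T : H₁ →ₗ[ℂ] H₁) _) : H₁) := by
    rw [← hw', map_sum]
    refine Finset.sum_congr rfl fun i _ => ?_
    exact Module.End.mem_eigenspace_iff.1 (f i).2
  have h1 : ‖w‖ ^ 2 = ∑ i ∈ f.support, ‖f i‖ ^ 2 := by
    rw [← hw']
    exact horth.norm_sum f f.support
  -- From `‖S w‖² = ⟪w, S† S w⟫`, expanded in the orthogonal eigencomponents of `w`.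
  have h2 : ‖S w‖ ^ 2 = ∑ i ∈ f.support, (i : ℝ) ^ 2 * ‖f i‖ ^ 2 := by
    have e1 : ((‖S w‖ ^ 2 : ℝ) : ℂ) = inner ℂ w (T w) := by
      rw [hT, ContinuousLinearMap.comp_apply, ContinuousLinearMap.adjoint_inner_right,
        inner_self_eq_norm_sq_to_K]
      simp
    have e2 : inner ℂ w (T w) = ∑ i ∈ f.support,
        inner ℂ (f i) (((((i : ℝ) ^ 2 : ℝ) : ℂ)) • f i) := by
      rw [hTw]
      nth_rewrite 1 [← hw']
      exact horth.inner_sum f (fun i => (((((i : ℝ) ^ 2 : ℝ) : ℂ)) • f i)) f.support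
    rw [e2] at e1
    have e3 : ((‖S w‖ ^ 2 : ℝ) : ℂ) = ((∑ i ∈ f.support, (i : ℝ) ^ 2 * ‖f i‖ ^ 2 : ℝ) : ℂ) := by
      rw [e1]
      push_cast
      refine Finset.sum_congr rfl fun i _ => ?_
      rw [inner_smul_right, inner_self_eq_norm_sq_to_K]
      simp
    exact_mod_cast e3
  refine le_of_sq_le_sq ?_ (norm_nonneg _)
  rw [mul_pow, h1, h2, Finset.mul_sum]
  refine Finset.sum_le_sum fun i _ => ?_
  have := i.2
  gcongr

/-- If `‖S u‖ ≤ ε ‖u‖` on the common kernel of at most `n` functionals, then `sₙ(S) ≤ ε`. -/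
lemma singularValue_le_of_functionals (S : H₁ →L[ℂ] H₂) {n : ℕ} {ε : ℝ} (hε : 0 ≤ ε)
    {ι : Type} [Fintype ι] (hι : Fintype.card ι ≤ n) (φ : ι → H₁ →L[ℂ] ℂ)
    (hS : ∀ u, (∀ i, φ i u = 0) → ‖S u‖ ≤ ε * ‖u‖) : singularValue S n ≤ ε := by
  refine Real.sSup_le ?_ hε
  rintro σ ⟨hσ, hrank⟩
  set W : Submodule ℂ H₁ := (⨆ (τ : ℝ) (_ : σ ≤ τ),
      Module.End.eigenspace ((ContinuousLinearMap.adjoint S ∘L S : H₁ →L[ℂ] H₁) : H₁ →ₗ[ℂ] H₁)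
        ((τ ^ 2 : ℝ) : ℂ) : Submodule ℂ H₁) with hW
  let Φ : W →ₗ[ℂ] (ι → ℂ) := (LinearMap.pi fun i => (φ i : H₁ →ₗ[ℂ] ℂ)) ∘ₗ W.subtype
  -- Dimension count: `W` has dimension at least `n + 1`, the target at most `n`.
  have hninj : ¬ Function.Injective Φ := by
    intro hinj
    have h := LinearMap.lift_rank_le_of_injective Φ hinj
    rw [rank_fun'] at h
    have h2 := (Cardinal.lift_le.2 hrank).trans h
    simp only [Cardinal.lift_natCast] at h2
    have h3 : n + 1 ≤ Fintype.card ι := by exact_mod_cast h2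
    omega
  rw [injective_iff_map_eq_zero] at hninj
  push Not at hninj
  obtain ⟨w, hw0, hwne⟩ := hninj
  have h1 := mul_norm_le_norm_of_mem_iSup_eigenspace S hσ w.2
  have h2 := hS w fun i => congrFun hw0 i
  have hpos : 0 < ‖(w : H₁)‖ := norm_pos_iff.2 (by simpa using hwne)
  exact le_of_mul_le_mul_right (h1.trans h2) hpos

/-- If for every `ε > 0` the bound `‖S u‖ ≤ ε ‖u‖` holds on the common kernel of finitely many
functionals, then `S` is compact. -/
lemma isCompactOperator_of_functionals (S : H₁ →L[ℂ] H₂)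
    (hS : ∀ ε : ℝ, 0 < ε → ∃ (ι : Type) (_ : Fintype ι) (φ : ι → H₁ →L[ℂ] ℂ),
      ∀ u, (∀ i, φ i u = 0) → ‖S u‖ ≤ ε * ‖u‖) : IsCompactOperator S := by
  have hcl : IsClosed {A : H₁ →L[ℂ] H₂ | IsCompactOperator A} :=
    isClosed_setOfPred_isCompactOperator
  refine hcl.closure_subset (Metric.mem_closure_iff.2 fun ε hε => ?_)
  -- With `V` the common kernel, `S` composed with the projection onto `Vᗮ` has finite rank and
  -- differs from `S` by `S` composed with the projection onto `V`, of norm at most `ε / 2`.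
  obtain ⟨ι, _, φ, hφ⟩ := hS (ε / 2) (half_pos hε)
  let Φ : H₁ →L[ℂ] (ι → ℂ) := ContinuousLinearMap.pi φ
  let V : Submodule ℂ H₁ := LinearMap.ker (Φ : H₁ →ₗ[ℂ] (ι → ℂ))
  have hV : IsClosed (V : Set H₁) := Φ.isClosed_ker
  have : CompleteSpace V := hV.completeSpace_coe
  have : FiniteDimensional ℂ Vᗮ := by
    refine FiniteDimensional.of_injective ((Φ : H₁ →ₗ[ℂ] (ι → ℂ)) ∘ₗ Vᗮ.subtype) ?_
    rw [injective_iff_map_eq_zero]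
    intro w hw
    have h1 : (w : H₁) ∈ V ⊓ Vᗮ := ⟨hw, w.2⟩
    rw [Submodule.inf_orthogonal_eq_bot] at h1
    simpa using h1
  refine ⟨S ∘L (Vᗮ.subtypeL ∘L Vᗮ.orthogonalProjectionOnto), ?_, ?_⟩
  · have h1 : IsCompactOperator (Vᗮ.orthogonalProjectionOnto : H₁ → Vᗮ) :=
      isCompactOperator_of_locallyCompactSpace_dom _
    exact h1.clm_comp (S ∘L Vᗮ.subtypeL)
  · rw [dist_eq_norm]
    refine lt_of_le_of_lt (ContinuousLinearMap.opNorm_le_bound _ (half_pos hε).le fun u => ?_)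
      (half_lt_self hε)
    have hdec : u - (Vᗮ.orthogonalProjectionOnto u : H₁) = (V.orthogonalProjectionOnto u : H₁) := by
      have := V.starProjection_add_starProjection_orthogonal u
      rw [Submodule.starProjection_apply, Submodule.starProjection_apply] at this
      rw [sub_eq_iff_eq_add]
      exact this.symm
    have h2 : (S - S ∘L (Vᗮ.subtypeL ∘L Vᗮ.orthogonalProjectionOnto)) u =
        S (V.orthogonalProjectionOnto u : H₁) := by
      rw [← hdec]
      simp
    rw [h2]
    refine (hφ _ fun i => ?_).trans ?_
    · have h3 : Φ (V.orthogonalProjectionOnto u : H₁) = 0 := (V.orthogonalProjectionOnto u).2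
      exact congrFun h3 i
    · gcongr
      exact V.norm_orthogonalProjectionOnto_apply_le u

/-- If for small `h` the bound `‖S u‖ ≤ (C h) ^ γ ‖u‖` holds on the common kernel of
`O(h ^ (-2))` functionals, then `S` is in the `q`-Schatten class for `q > 2 / γ`. -/
lemma isSchattenClass_of_functionals (S : H₁ →L[ℂ] H₂) {γ : ℕ} (hγ : 1 ≤ γ) {q : ℝ}
    (hq : 2 / (γ : ℝ) < q) {C δ : ℝ} (hC : 0 < C) (hδ : 0 < δ)
    (hS : ∀ h : ℝ, 0 < h → h ≤ δ → ∃ (ι : Type) (_ : Fintype ι) (φ : ι → H₁ →L[ℂ] ℂ),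
      (Fintype.card ι : ℝ) ≤ C / h ^ 2 ∧
      ∀ u, (∀ i, φ i u = 0) → ‖S u‖ ≤ (C * h) ^ γ * ‖u‖) : IsSchattenClass q S := by
  have hγ0 : (0 : ℝ) < γ := by exact_mod_cast hγ
  have hq0 : 0 < q := (by positivity : (0 : ℝ) < 2 / γ).trans hq
  constructor
  · refine isCompactOperator_of_functionals S fun ε hε => ?_
    have hmin : 0 < min 1 ε := lt_min one_pos hε
    -- This `h` makes `C h ≤ min 1 ε`; since `γ ≥ 1`, the power `(C h)^γ` is then at most `ε`.
    obtain ⟨ι, hι, φ, -, hφ⟩ := hS (min δ (min 1 ε / C)) (by positivity) (min_le_left _ _)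
    refine ⟨ι, hι, φ, fun u hu => (hφ u hu).trans ?_⟩
    gcongr
    have h1 : C * min δ (min 1 ε / C) ≤ min 1 ε := by
      calc C * min δ (min 1 ε / C) ≤ C * (min 1 ε / C) := by
            gcongr
            exact min_le_right _ _
        _ = min 1 ε := by field_simp
    calc (C * min δ (min 1 ε / C)) ^ γ ≤ (min 1 ε) ^ γ := by gcongr
      _ ≤ min 1 ε := pow_le_of_le_one hmin.le (min_le_left _ _) (by omega)
      _ ≤ ε := min_le_right _ _
  · have hbound : ∀ᶠ n : ℕ in Filter.atTop,
        singularValue S n ≤ (C * Real.sqrt (C / n)) ^ γ := by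
      have ht : Filter.Tendsto (fun n : ℕ => Real.sqrt (C / n)) Filter.atTop (nhds 0) := by
        have h := (tendsto_const_div_atTop_nhds_zero_nat C)
        have h2 := (Real.continuous_sqrt.tendsto 0).comp h
        rwa [Real.sqrt_zero] at h2
      filter_upwards [ht.eventually_le_const hδ, Filter.eventually_gt_atTop 0] with n hn hn0
      have hn0' : (0 : ℝ) < n := by exact_mod_cast hn0
      have hpos : 0 < Real.sqrt (C / n) := Real.sqrt_pos.2 (by positivity)
      -- Here `h = √(C / n)`, for which the allowed number `C / h²` of functionals is exactly `n`.
      obtain ⟨ι, hι, φ, hcard, hφ⟩ := hS _ hpos hn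
      refine singularValue_le_of_functionals S (by positivity) ?_ φ hφ
      rw [Real.sq_sqrt (by positivity), div_div_cancel₀ hC.ne'] at hcard
      exact_mod_cast hcard
    have hsum : Summable fun n : ℕ => singularValue S n ^ q := by
      have hs : Summable fun n : ℕ =>
          (C * Real.sqrt C) ^ (γ * q) * (n : ℝ) ^ (-(γ * q / 2)) := by
        refine Summable.mul_left _ (Real.summable_nat_rpow.2 ?_)
        have : 2 < q * γ := (div_lt_iff₀ hγ0).1 hq
        linarith
      refine Summable.of_norm_bounded_eventually_nat hs ?_
      filter_upwards [hbound, Filter.eventually_gt_atTop 0] with n hn hn0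
      have hn0' : (0 : ℝ) < n := by exact_mod_cast hn0
      rw [Real.norm_of_nonneg (Real.rpow_nonneg (singularValue_nonneg S n) q)]
      refine (Real.rpow_le_rpow (singularValue_nonneg S n) hn hq0.le).trans (le_of_eq ?_)
      rw [Real.sqrt_div hC.le, ← mul_div_assoc, ← Real.rpow_natCast, ← Real.rpow_mul (by positivity),
        Real.div_rpow (by positivity) (by positivity), Real.rpow_neg hn0'.le, div_eq_mul_inv,
        Real.sqrt_eq_rpow (n : ℝ), ← Real.rpow_mul hn0'.le]
      congr 3
      ring
    unfold schattenNorm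
    refine ENNReal.rpow_lt_top_of_nonneg (by positivity) ?_
    have : ∀ n, ENNReal.ofReal (singularValue S n) ^ q =
        ENNReal.ofReal (singularValue S n ^ q) := fun n =>
      ENNReal.ofReal_rpow_of_nonneg (singularValue_nonneg S n) hq0.le
    simp only [this]
    exact hsum.tsum_ofReal_ne_top

end Schatten

/-! ### A Poincaré inequality -/

/-- `(∫ f)² ≤ μ(s) ∫ f²`. -/
lemma setLIntegral_sq_le {α : Type*} [MeasurableSpace α] (μ : Measure α) (s : Set α)
    {f : α → ENNReal} (hf : AEMeasurable f (μ.restrict s)) :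
    (∫⁻ x in s, f x ∂μ) ^ 2 ≤ μ s * ∫⁻ x in s, f x ^ 2 ∂μ := by
  have h := ENNReal.lintegral_mul_le_Lp_mul_Lq (μ.restrict s) Real.HolderConjugate.two_two
    (aemeasurable_const (b := (1 : ENNReal))) hf
  have h2 := pow_le_pow_left' h 2
  rw [mul_pow, ← ENNReal.rpow_natCast, ← ENNReal.rpow_natCast, ← ENNReal.rpow_natCast,
    ← ENNReal.rpow_mul, ← ENNReal.rpow_mul] at h2
  simpa using h2

/-- The map `x ↦ a + c x` scales area by `c² ≥ 1/4`, whence the constant `4`. -/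
lemma lintegral_add_smul_le {f : EuclideanSpace ℝ (Fin 2) → ENNReal} (hf : Measurable f)
    (a : EuclideanSpace ℝ (Fin 2)) {c : ℝ} (hc : 1 / 2 ≤ c) :
    ∫⁻ x, f (a + c • x) ≤ 4 * ∫⁻ x, f x := by
  have hc0 : 0 < c := by linarith
  have h1 : ∫⁻ x, f (a + c • x) = ∫⁻ y, f (a + y)
      ∂(Measure.map (fun x : EuclideanSpace ℝ (Fin 2) => c • x) volume) := by
    rw [lintegral_map (by fun_prop) (by fun_prop)]
  rw [h1, Measure.map_addHaar_smul volume hc0.ne', lintegral_smul_measure,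
    lintegral_add_left_eq_self (μ := (volume : Measure (EuclideanSpace ℝ (Fin 2)))) f a,
    finrank_euclideanSpace_fin, smul_eq_mul]
  gcongr
  rw [abs_of_nonneg (by positivity), ENNReal.ofReal_le_iff_le_toReal (by simp)]
  have : (1 / 2) ^ 2 ≤ c ^ 2 := by gcongr
  rw [inv_le_comm₀ (by positivity) (by simp)]
  norm_num at this ⊢
  linarith

/-- Averaging a function over the segments from the points of `D` to those of `B`. -/
lemma lintegral_lintegral_lineMap_le {D B : Set (EuclideanSpace ℝ (Fin 2))}
    (hB : volume B ≤ volume D)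
    {f : EuclideanSpace ℝ (Fin 2) → ENNReal} (hf : Measurable f) (θ : ℝ) :
    ∫⁻ x in D, ∫⁻ y in B, f (x + θ • (y - x)) ≤ 4 * volume D * ∫⁻ x, f x := by
  have e : ∀ x y : EuclideanSpace ℝ (Fin 2), x + θ • (y - x) = (1 - θ) • x + θ • y := by
    intro x y
    module
  simp only [e]
  have hm : Measurable fun p : EuclideanSpace ℝ (Fin 2) × EuclideanSpace ℝ (Fin 2) =>
      f ((1 - θ) • p.1 + θ • p.2) := hf.comp (by fun_prop)
  -- Substituting in the variable with the larger coefficient keeps the Jacobian bounded uniformly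
  -- in `θ`: `y` if `θ ≥ 1/2`, otherwise `x`.
  rcases le_total (1 / 2) θ with h | h
  · calc ∫⁻ x in D, ∫⁻ y in B, f ((1 - θ) • x + θ • y)
        ≤ ∫⁻ x in D, 4 * ∫⁻ x, f x := by
          refine lintegral_mono fun x => ?_
          exact (setLIntegral_le_lintegral _ _).trans (lintegral_add_smul_le hf _ h)
      _ = 4 * volume D * ∫⁻ x, f x := by
          rw [setLIntegral_const]
          ring
  · calc ∫⁻ x in D, ∫⁻ y in B, f ((1 - θ) • x + θ • y)
        = ∫⁻ y in B, ∫⁻ x in D, f ((1 - θ) • x + θ • y) :=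
          lintegral_lintegral_swap hm.aemeasurable
      _ ≤ ∫⁻ y in B, 4 * ∫⁻ x, f x := by
          refine lintegral_mono fun y => ?_
          simp only [add_comm _ (θ • y)]
          exact (setLIntegral_le_lintegral _ _).trans
            (lintegral_add_smul_le hf _ (by linarith))
      _ = 4 * volume B * ∫⁻ x, f x := by
          rw [setLIntegral_const]
          ring
      _ ≤ 4 * volume D * ∫⁻ x, f x := by gcongr

/-- The increment of a `C¹` function along a segment. -/
lemma enorm_sub_sq_le_lintegral_fderiv {v : EuclideanSpace ℝ (Fin 2) → ℂ} (hv : ContDiff ℝ 1 v)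
    {d : ℝ} {x y : EuclideanSpace ℝ (Fin 2)} (hd : ‖y - x‖ ≤ d) :
    ‖v y - v x‖ₑ ^ 2 ≤ ENNReal.ofReal (d ^ 2) *
      ∫⁻ θ in Set.Icc (0 : ℝ) 1, ‖fderiv ℝ v (x + θ • (y - x))‖ₑ ^ 2 := by
  have hd0 : 0 ≤ d := (norm_nonneg _).trans hd
  have hc : Continuous fun θ : ℝ => fderiv ℝ v (x + θ • (y - x)) :=
    (hv.continuous_fderiv (by simp)).comp (by fun_prop)
  have hder : ∀ θ : ℝ, HasDerivAt (fun θ : ℝ => v (x + θ • (y - x)))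
      (fderiv ℝ v (x + θ • (y - x)) (y - x)) θ := by
    intro θ
    have h1 : HasDerivAt (fun θ : ℝ => x + θ • (y - x)) (y - x) θ := by
      simpa using ((hasDerivAt_id θ).smul_const (y - x)).const_add x
    exact ((hv.differentiable (by simp)) _).hasFDerivAt.comp_hasDerivAt θ h1
  have hint : v y - v x = ∫ θ in Set.Icc (0 : ℝ) 1, fderiv ℝ v (x + θ • (y - x)) (y - x) := by
    rw [integral_Icc_eq_integral_Ioc, ← intervalIntegral.integral_of_le zero_le_one,
      intervalIntegral.integral_eq_sub_of_hasDerivAt (fun θ _ => hder θ)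
        (Continuous.intervalIntegrable (hc.clm_apply continuous_const) _ _)]
    simp
  have hle : ‖v y - v x‖ₑ ≤ ENNReal.ofReal d *
      ∫⁻ θ in Set.Icc (0 : ℝ) 1, ‖fderiv ℝ v (x + θ • (y - x))‖ₑ := by
    rw [hint, ← lintegral_const_mul' _ _ ENNReal.ofReal_ne_top]
    refine (enorm_integral_le_lintegral_enorm _).trans (lintegral_mono fun θ => ?_)
    rw [← ofReal_norm, ← ofReal_norm, ← ENNReal.ofReal_mul hd0]
    refine ENNReal.ofReal_le_ofReal ?_
    refine (ContinuousLinearMap.le_opNorm _ _).trans ?_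
    rw [mul_comm]
    gcongr
  calc ‖v y - v x‖ₑ ^ 2
      ≤ (ENNReal.ofReal d *
        ∫⁻ θ in Set.Icc (0 : ℝ) 1, ‖fderiv ℝ v (x + θ • (y - x))‖ₑ) ^ 2 := by gcongr
    _ ≤ ENNReal.ofReal (d ^ 2) *
      ∫⁻ θ in Set.Icc (0 : ℝ) 1, ‖fderiv ℝ v (x + θ • (y - x))‖ₑ ^ 2 := by
        rw [mul_pow, ENNReal.ofReal_pow hd0]
        gcongr
        refine (setLIntegral_sq_le volume _ (hc.enorm.measurable.aemeasurable)).trans ?_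
        simp

/-- Each increment is bounded by the gradient along the segment, which stays in `D`. After
exchanging integrals, the average over segments is bounded uniformly in `θ`, so integrating over
`[0, 1]` costs nothing. -/
lemma lintegral_lintegral_enorm_sub_sq_le {D B : Set (EuclideanSpace ℝ (Fin 2))}
    (hD : MeasurableSet D) (hB : MeasurableSet B) (hBD : B ⊆ D)
    (hstar : ∀ x ∈ D, ∀ y ∈ B, ∀ θ ∈ Set.Icc (0 : ℝ) 1, x + θ • (y - x) ∈ D)
    {d : ℝ} (hd : ∀ x ∈ D, ∀ y ∈ B, ‖y - x‖ ≤ d)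
    {v : EuclideanSpace ℝ (Fin 2) → ℂ} (hv : ContDiff ℝ 1 v) :
    ∫⁻ x in D, ∫⁻ y in B, ‖v y - v x‖ₑ ^ 2 ≤
      ENNReal.ofReal (d ^ 2) * (4 * volume D * ∫⁻ x in D, ‖fderiv ℝ v x‖ₑ ^ 2) := by
  -- Extension by zero allows changes of variables on the whole plane while retaining only the
  -- gradient on `D`.
  set F : EuclideanSpace ℝ (Fin 2) → ENNReal :=
    D.indicator fun x => ‖fderiv ℝ v x‖ₑ ^ 2 with hF
  have hFm : Measurable F :=
    ((hv.continuous_fderiv (by simp)).enorm.measurable.pow_const 2).indicator hD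
  have hFi : ∫⁻ x in D, ‖fderiv ℝ v x‖ₑ ^ 2 = ∫⁻ x, F x := (lintegral_indicator hD _).symm
  have hm1 : Measurable fun p : (EuclideanSpace ℝ (Fin 2) × EuclideanSpace ℝ (Fin 2)) × ℝ =>
      F (p.1.1 + p.2 • (p.1.2 - p.1.1)) := hFm.comp (by fun_prop)
  have hpt : ∀ x ∈ D, ∀ y ∈ B, ‖v y - v x‖ₑ ^ 2 ≤ ENNReal.ofReal (d ^ 2) *
      ∫⁻ θ in Set.Icc (0 : ℝ) 1, F (x + θ • (y - x)) := by
    intro x hx y hy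
    refine (enorm_sub_sq_le_lintegral_fderiv hv (hd x hx y hy)).trans (le_of_eq ?_)
    congr 1
    refine setLIntegral_congr_fun measurableSet_Icc fun θ hθ => ?_
    rw [hF, Set.indicator_of_mem (hstar x hx y hy θ hθ)]
  calc ∫⁻ x in D, ∫⁻ y in B, ‖v y - v x‖ₑ ^ 2
      ≤ ∫⁻ x in D, ∫⁻ y in B, ENNReal.ofReal (d ^ 2) *
          ∫⁻ θ in Set.Icc (0 : ℝ) 1, F (x + θ • (y - x)) :=
        setLIntegral_mono' hD fun x hx => setLIntegral_mono' hB fun y hy => hpt x hx y hy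
    _ = ENNReal.ofReal (d ^ 2) * ∫⁻ x in D, ∫⁻ y in B,
          ∫⁻ θ in Set.Icc (0 : ℝ) 1, F (x + θ • (y - x)) := by
        rw [← lintegral_const_mul' _ _ ENNReal.ofReal_ne_top]
        refine lintegral_congr fun x => ?_
        rw [← lintegral_const_mul' _ _ ENNReal.ofReal_ne_top]
    _ = ENNReal.ofReal (d ^ 2) * ∫⁻ θ in Set.Icc (0 : ℝ) 1, ∫⁻ x in D, ∫⁻ y in B,
          F (x + θ • (y - x)) := by
        congr 1
        have e1 : ∀ x, ∫⁻ y in B, ∫⁻ θ in Set.Icc (0 : ℝ) 1, F (x + θ • (y - x)) =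
            ∫⁻ θ in Set.Icc (0 : ℝ) 1, ∫⁻ y in B, F (x + θ • (y - x)) := by
          intro x
          refine lintegral_lintegral_swap (f := fun y θ => F (x + θ • (y - x))) ?_
          exact (hFm.comp (by fun_prop)).aemeasurable
        simp only [e1]
        refine lintegral_lintegral_swap
          (f := fun x θ => ∫⁻ y in B, F (x + θ • (y - x))) ?_
        refine Measurable.aemeasurable ?_
        refine Measurable.lintegral_prod_right (f := fun (p : EuclideanSpace ℝ (Fin 2) × ℝ)
          (y : EuclideanSpace ℝ (Fin 2)) => F (p.1 + p.2 • (y - p.1))) ?_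
        exact hFm.comp (by fun_prop)
    _ ≤ ENNReal.ofReal (d ^ 2) * ∫⁻ θ in Set.Icc (0 : ℝ) 1, 4 * volume D * ∫⁻ x, F x := by
        gcongr
        exact lintegral_lintegral_lineMap_le (measure_mono hBD) hFm _
    _ = ENNReal.ofReal (d ^ 2) * (4 * volume D * ∫⁻ x in D, ‖fderiv ℝ v x‖ₑ ^ 2) := by
        rw [setLIntegral_const, hFi]
        simp

/-- Poincaré inequality on a set `D` that is star-shaped with respect to all points of a
subset `B` of comparable measure. -/
lemma lintegral_sq_le_of_starShaped {D B : Set (EuclideanSpace ℝ (Fin 2))}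
    (hD : MeasurableSet D) (hB : MeasurableSet B) (hBD : B ⊆ D)
    (hstar : ∀ x ∈ D, ∀ y ∈ B, ∀ θ ∈ Set.Icc (0 : ℝ) 1, x + θ • (y - x) ∈ D)
    {d : ℝ} (hd : ∀ x ∈ D, ∀ y ∈ B, ‖y - x‖ ≤ d) (hB0 : volume B ≠ 0) (hBt : volume B ≠ ⊤)
    (hDB : volume D ≤ 4 * volume B) (hbd : Bornology.IsBounded B)
    {v : EuclideanSpace ℝ (Fin 2) → ℂ} (hv : ContDiff ℝ 1 v) :
    ∫⁻ x in D, ‖v x‖ₑ ^ 2 ≤ 32 * ENNReal.ofReal (d ^ 2) * (∫⁻ x in D, ‖fderiv ℝ v x‖ₑ ^ 2) +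
      8 * (volume B)⁻¹ * ‖∫ y in B, v y‖ₑ ^ 2 := by
  set b := volume B with hb
  set I := ‖∫ y in B, v y‖ₑ ^ 2 with hI
  set G := ∫⁻ x in D, ‖fderiv ℝ v x‖ₑ ^ 2 with hG
  have hvi : IntegrableOn v B :=
    (hv.continuous.continuousOn.integrableOn_compact
      (hbd.isCompact_closure)).mono_set subset_closure
  -- Compare `v x` with its mean over `B`: `b v(x) = ∫_B v - ∫_B (v(y) - v(x)) dy`, then
  -- Cauchy–Schwarz. The factor `b²` is cancelled only at the end.
  have hpt : ∀ x, b ^ 2 * ‖v x‖ₑ ^ 2 ≤ 2 * b * (∫⁻ y in B, ‖v y - v x‖ₑ ^ 2) + 2 * I := by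
    intro x
    have hc : IntegrableOn (fun _ => v x) B := integrableOn_const hBt
    have e1 : (volume.real B : ℂ) * v x = (∫ y in B, v y) - ∫ y in B, (v y - v x) := by
      rw [integral_sub hvi hc, setIntegral_const]
      simp
    have e2 : b * ‖v x‖ₑ ≤ ‖∫ y in B, v y‖ₑ + ∫⁻ y in B, ‖v y - v x‖ₑ := by
      have : b * ‖v x‖ₑ = ‖(volume.real B : ℂ) * v x‖ₑ := by
        rw [enorm_mul, ← ofReal_norm (volume.real B : ℂ), Complex.norm_real,
          Real.norm_of_nonneg measureReal_nonneg, Measure.real, ENNReal.ofReal_toReal hBt]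
      rw [this, e1]
      refine (enorm_sub_le).trans ?_
      gcongr
      exact enorm_integral_le_lintegral_enorm _
    have e3 : (∫⁻ y in B, ‖v y - v x‖ₑ) ^ 2 ≤ b * ∫⁻ y in B, ‖v y - v x‖ₑ ^ 2 :=
      setLIntegral_sq_le volume B
        ((hv.continuous.sub continuous_const).enorm.measurable.aemeasurable)
    calc b ^ 2 * ‖v x‖ₑ ^ 2 = (b * ‖v x‖ₑ) ^ 2 := by ring
      _ ≤ (‖∫ y in B, v y‖ₑ + ∫⁻ y in B, ‖v y - v x‖ₑ) ^ 2 := by gcongr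
      _ ≤ 2 * (‖∫ y in B, v y‖ₑ ^ 2 + (∫⁻ y in B, ‖v y - v x‖ₑ) ^ 2) := by
        have := ENNReal.rpow_add_le_mul_rpow_add_rpow ‖∫ y in B, v y‖ₑ
          (∫⁻ y in B, ‖v y - v x‖ₑ) (p := 2) (by norm_num)
        norm_num at this
        exact this
      _ ≤ 2 * (I + b * ∫⁻ y in B, ‖v y - v x‖ₑ ^ 2) := by gcongr
      _ = _ := by ring
  have hmain : b ^ 2 * ∫⁻ x in D, ‖v x‖ₑ ^ 2 ≤
      b ^ 2 * (32 * ENNReal.ofReal (d ^ 2) * G + 8 * b⁻¹ * I) := by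
    calc b ^ 2 * ∫⁻ x in D, ‖v x‖ₑ ^ 2
        = ∫⁻ x in D, b ^ 2 * ‖v x‖ₑ ^ 2 := by
          rw [lintegral_const_mul' _ _ (ENNReal.pow_ne_top hBt)]
      _ ≤ ∫⁻ x in D, (2 * b * (∫⁻ y in B, ‖v y - v x‖ₑ ^ 2) + 2 * I) :=
          lintegral_mono fun x => hpt x
      _ = 2 * b * (∫⁻ x in D, ∫⁻ y in B, ‖v y - v x‖ₑ ^ 2) + 2 * I * volume D := by
          rw [lintegral_add_right _ measurable_const, setLIntegral_const,
            lintegral_const_mul' _ _ (ENNReal.mul_ne_top (by simp) hBt)]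
      _ ≤ 2 * b * (ENNReal.ofReal (d ^ 2) * (4 * (4 * b) * G)) + 2 * I * (4 * b) := by
          gcongr
          refine (lintegral_lintegral_enorm_sub_sq_le hD hB hBD hstar hd hv).trans ?_
          gcongr
      _ = b ^ 2 * (32 * ENNReal.ofReal (d ^ 2) * G) + 8 * (b * I) := by ring
      _ = b ^ 2 * (32 * ENNReal.ofReal (d ^ 2) * G) + 8 * (b * (b * b⁻¹) * I) := by
          rw [ENNReal.mul_inv_cancel hB0 hBt, mul_one]
      _ = b ^ 2 * (32 * ENNReal.ofReal (d ^ 2) * G + 8 * b⁻¹ * I) := by ring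
  exact (ENNReal.mul_le_mul_iff_right (pow_ne_zero 2 hB0) (ENNReal.pow_ne_top hBt)).1 hmain

/-! ### Cells along the graph of a Lipschitz function -/

lemma EuclideanSpace.norm_le_abs_add_abs (z : EuclideanSpace ℝ (Fin 2)) :
    ‖z‖ ≤ |z 0| + |z 1| := by
  refine le_of_sq_le_sq ?_ (by positivity)
  rw [EuclideanSpace.norm_sq_eq, Fin.sum_univ_two, Real.norm_eq_abs, Real.norm_eq_abs]
  nlinarith [abs_nonneg (z 0), abs_nonneg (z 1)]

lemma volume_rotated_box (e : EuclideanSpace ℝ (Fin 2) ≃ₗᵢ[ℝ] EuclideanSpace ℝ (Fin 2))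
    (a b c d : ℝ) :
    volume {y | a ≤ e y 0 ∧ e y 0 < b ∧ c ≤ e y 1 ∧ e y 1 < d} =
      ENNReal.ofReal (b - a) * ENNReal.ofReal (d - c) := by
  have h1 : MeasurePreserving (fun y => WithLp.ofLp (e y)) volume volume :=
    (PiLp.volume_preserving_ofLp (Fin 2)).comp e.measurePreserving
  have h2 : {y | a ≤ e y 0 ∧ e y 0 < b ∧ c ≤ e y 1 ∧ e y 1 < d} =
      (fun y => WithLp.ofLp (e y)) ⁻¹' (Set.univ.pi fun i => Set.Ico (![a, c] i) (![b, d] i)) := by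
    ext y
    simp [Set.mem_pi, Fin.forall_fin_two, and_assoc]
  rw [h2, h1.measure_preimage
    (MeasurableSet.univ_pi fun i => measurableSet_Ico).nullMeasurableSet,
    Real.volume_pi_Ico, Fin.prod_univ_two]
  simp

/-- In the coordinates given by `e`, the part above the graph of `g` of the square-like cell of
size `h` with label `p`; in each column, all of the space between the graph and the cell with
label `1` belongs to the cell with label `0`. -/
def graphCell (e : EuclideanSpace ℝ (Fin 2) ≃ₗᵢ[ℝ] EuclideanSpace ℝ (Fin 2)) (g : ℝ → ℝ)
    (K h : ℝ) (p : ℤ × ℕ) : Set (EuclideanSpace ℝ (Fin 2)) :=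
  {y | p.1 * h ≤ e y 0 ∧ e y 0 < (p.1 + 1) * h ∧ g (e y 0) < e y 1 ∧
    (p.2 = 0 ∨ g (p.1 * h) + 3 * p.2 * (K * h) ≤ e y 1) ∧
    e y 1 < g (p.1 * h) + 3 * (p.2 + 1) * (K * h)}

/-- The upper part of `graphCell`, a rectangle with respect to which it is star-shaped. -/
def graphCore (e : EuclideanSpace ℝ (Fin 2) ≃ₗᵢ[ℝ] EuclideanSpace ℝ (Fin 2)) (g : ℝ → ℝ)
    (K h : ℝ) (p : ℤ × ℕ) : Set (EuclideanSpace ℝ (Fin 2)) :=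
  {y | p.1 * h ≤ e y 0 ∧ e y 0 < (p.1 + 1) * h ∧
    g (p.1 * h) + (3 * p.2 + 2) * (K * h) ≤ e y 1 ∧
    e y 1 < g (p.1 * h) + 3 * (p.2 + 1) * (K * h)}

section Cells

variable {e : EuclideanSpace ℝ (Fin 2) ≃ₗᵢ[ℝ] EuclideanSpace ℝ (Fin 2)} {g : ℝ → ℝ}
  {K : NNReal} {h : ℝ}

lemma measurableSet_graphCell (hg : LipschitzWith K g) (p : ℤ × ℕ) :
    MeasurableSet (graphCell e g K h p) := by
  have h0 : Measurable fun y => e y 0 := by fun_prop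
  have h1 : Measurable fun y => e y 1 := by fun_prop
  have h2 : Measurable fun y => g (e y 0) := hg.continuous.measurable.comp h0
  exact (measurableSet_le measurable_const h0).inter <|
    (measurableSet_lt h0 measurable_const).inter <| (measurableSet_lt h2 h1).inter <|
    ((MeasurableSet.const _).union (measurableSet_le measurable_const h1)).inter <|
    measurableSet_lt h1 measurable_const

lemma measurableSet_graphCore (p : ℤ × ℕ) : MeasurableSet (graphCore e g K h p) := by
  have h0 : Measurable fun y => e y 0 := by fun_prop
  have h1 : Measurable fun y => e y 1 := by fun_prop
  exact (measurableSet_le measurable_const h0).inter <|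
    (measurableSet_lt h0 measurable_const).inter <|
    (measurableSet_le measurable_const h1).inter <| measurableSet_lt h1 measurable_const

lemma LipschitzWith.abs_sub_lt_of_mem_column (hg : LipschitzWith K g) (hK : 1 ≤ K) {k s : ℝ}
    (h1 : k * h ≤ s) (h2 : s < (k + 1) * h) : |g s - g (k * h)| < K * h := by
  have hK0 : (0 : ℝ) < K := by exact_mod_cast zero_lt_one.trans_le hK
  have h3 := hg.dist_le_mul s (k * h)
  rw [Real.dist_eq, Real.dist_eq, abs_of_nonneg (sub_nonneg.2 h1)] at h3
  refine h3.trans_lt ?_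
  gcongr
  linarith

lemma graphCore_subset_graphCell (hg : LipschitzWith K g) (hK : 1 ≤ K) (hh : 0 < h)
    (p : ℤ × ℕ) : graphCore e g K h p ⊆ graphCell e g K h p := by
  rintro y ⟨h1, h2, h3, h4⟩
  have hKh : 0 < K * h := mul_pos (by exact_mod_cast zero_lt_one.trans_le hK) hh
  have hp : 0 ≤ (p.2 : ℝ) * (K * h) := by positivity
  have h5 := abs_lt.1 (hg.abs_sub_lt_of_mem_column hK h1 h2)
  refine ⟨h1, h2, ?_, Or.inr ?_, h4⟩ <;> nlinarith [h5.2]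

/-- Only the bottom cell of a column reaches below its nominal height, and the graph dips there by
less than `K h`. -/
lemma sub_le_of_mem_graphCell (hg : LipschitzWith K g) (hK : 1 ≤ K) {p : ℤ × ℕ}
    {y : EuclideanSpace ℝ (Fin 2)} (hh : 0 < h) (hy : y ∈ graphCell e g K h p) :
    g (p.1 * h) + (3 * p.2 - 1) * (K * h) ≤ e y 1 := by
  obtain ⟨h1, h2, h3, h4, -⟩ := hy
  have h5 := abs_lt.1 (hg.abs_sub_lt_of_mem_column hK h1 h2)
  have hKh : 0 ≤ K * h := by positivity
  rcases h4 with h4 | h4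
  · rw [h4]
    simp only [Nat.cast_zero]
    linarith [h5.1]
  · linarith

lemma norm_sub_le_of_mem_graphCell (hg : LipschitzWith K g) (hK : 1 ≤ K) (hh : 0 < h)
    {p : ℤ × ℕ} {x y : EuclideanSpace ℝ (Fin 2)} (hx : x ∈ graphCell e g K h p)
    (hy : y ∈ graphCell e g K h p) : ‖y - x‖ ≤ 5 * (K * h) := by
  have hK' : (1 : ℝ) ≤ K := by exact_mod_cast hK
  have hx1 := sub_le_of_mem_graphCell hg hK hh hx
  have hy1 := sub_le_of_mem_graphCell hg hK hh hy
  obtain ⟨a1, a2, -, -, a5⟩ := hx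
  obtain ⟨b1, b2, -, -, b5⟩ := hy
  rw [← e.norm_map]
  refine (EuclideanSpace.norm_le_abs_add_abs _).trans ?_
  simp only [map_sub, PiLp.sub_apply]
  have c1 : |e y 0 - e x 0| ≤ h := abs_le.2 ⟨by linarith, by linarith⟩
  have c2 : |e y 1 - e x 1| ≤ 4 * (K * h) := abs_le.2 ⟨by linarith, by linarith⟩
  nlinarith

/-- Only staying above the graph is delicate. Moving from `x` a fraction `θ` of the way to `y`
raises the graph by at most `θ K h`, while the target height exceeds `g (e x 0)` by more than `K h`.
-/
lemma add_smul_mem_graphCell (hg : LipschitzWith K g) {p : ℤ × ℕ}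
    (hK : 1 ≤ K) (hh : 0 < h) {x y : EuclideanSpace ℝ (Fin 2)}
    (hx : x ∈ graphCell e g K h p) (hy : y ∈ graphCore e g K h p) {θ : ℝ}
    (hθ : θ ∈ Set.Icc (0 : ℝ) 1) : x + θ • (y - x) ∈ graphCell e g K h p := by
  obtain ⟨a1, a2, a3, a4, a5⟩ := hx
  obtain ⟨b1, b2, b3, b4⟩ := hy
  obtain ⟨h0, h1⟩ := hθ
  have e0 : ∀ i, e (x + θ • (y - x)) i = (1 - θ) * e x i + θ * e y i := by
    intro i
    simp only [map_add, map_smul, map_sub, PiLp.add_apply, PiLp.smul_apply, PiLp.sub_apply,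
      smul_eq_mul]
    ring
  have hlt : ∀ {a b c : ℝ}, a < c → b < c → (1 - θ) * a + θ * b < c := by
    intro a b c ha hb
    rcases h0.eq_or_lt with hz | hz
    · rw [← hz]
      linarith
    · nlinarith
  have hle : ∀ {a b c : ℝ}, c ≤ a → c ≤ b → c ≤ (1 - θ) * a + θ * b := by
    intro a b c ha hb
    nlinarith
  have hKh : 0 < K * h := mul_pos (by exact_mod_cast zero_lt_one.trans_le hK) hh
  have hp : 0 ≤ (p.2 : ℝ) * (K * h) := by positivity
  have hs1 := hle a1 b1
  have hs2 := hlt a2 b2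
  refine ⟨by rwa [e0], by rwa [e0], ?_, ?_, ?_⟩
  · simp only [e0]
    set s := (1 - θ) * e x 0 + θ * e y 0 with hs
    have c1 := abs_lt.1 (hg.abs_sub_lt_of_mem_column hK a1 a2)
    have c2 : g s ≤ g (e x 0) + θ * (K * h) := by
      have c3 := hg.dist_le_mul s (e x 0)
      rw [Real.dist_eq, Real.dist_eq] at c3
      have c4 : |s - e x 0| ≤ θ * h := by
        have : s - e x 0 = θ * (e y 0 - e x 0) := by
          rw [hs]
          ring
        rw [this, abs_mul, abs_of_nonneg h0]
        gcongr
        exact abs_le.2 ⟨by linarith, by linarith⟩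
      have c5 : (K : ℝ) * |s - e x 0| ≤ K * (θ * h) := by gcongr
      linarith [(abs_le.1 c3).2]
    -- This is why the core starts `2 K h` above the base of its cell: one `K h` for the variation
    -- of `g` between `p.1 * h` and `e x 0`, one for the segment.
    have c6 : g (e x 0) + K * h < e y 1 := by linarith [c1.2]
    rw [show (1 - θ) * e x 1 + θ * e y 1 = e x 1 + θ * (e y 1 - e x 1) by ring]
    rcases h0.eq_or_lt with hz | hz
    · rw [← hz] at c2 ⊢
      linarith
    · have c7 : θ * (g (e x 0) + K * h) < θ * e y 1 := by gcongr
      have c8 : (1 - θ) * g (e x 0) ≤ (1 - θ) * e x 1 :=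
        mul_le_mul_of_nonneg_left a3.le (by linarith)
      linarith
  · refine a4.imp_right fun a4 => ?_
    rw [e0]
    exact hle a4 (by linarith)
  · rw [e0]
    exact hlt a5 b4

end Cells

section Cells

variable {e : EuclideanSpace ℝ (Fin 2) ≃ₗᵢ[ℝ] EuclideanSpace ℝ (Fin 2)} {g : ℝ → ℝ}
  {K : NNReal} {h : ℝ}

lemma exists_mem_graphCell (hK : 1 ≤ K) (hh : 0 < h) {y : EuclideanSpace ℝ (Fin 2)}
    (hy : g (e y 0) < e y 1) : ∃ p, y ∈ graphCell e g K h p := by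
  have hKh : 0 < 3 * (K * h) :=
    mul_pos three_pos (mul_pos (by exact_mod_cast zero_lt_one.trans_le hK) hh)
  set k := ⌊e y 0 / h⌋ with hk
  set j := ⌊(e y 1 - g (k * h)) / (3 * (K * h))⌋₊ with hj
  refine ⟨(k, j), ?_, ?_, hy, ?_, ?_⟩
  · exact (le_div_iff₀ hh).1 (Int.floor_le _)
  · exact (div_lt_iff₀ hh).1 (Int.lt_floor_add_one _)
  · rcases Nat.eq_zero_or_pos j with h0 | h0
    · exact Or.inl h0
    · right
      have h1 := (Nat.le_floor_iff' h0.ne').1 hj.le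
      rw [le_div_iff₀ hKh] at h1
      simp only
      linarith
  · have h1 := Nat.lt_floor_add_one ((e y 1 - g (k * h)) / (3 * (K * h)))
    rw [← hj, div_lt_iff₀ hKh] at h1
    simp only
    linarith

lemma eq_of_mem_graphCell (hK : 1 ≤ K) (hh : 0 < h) {y : EuclideanSpace ℝ (Fin 2)}
    {p p' : ℤ × ℕ} (hp : y ∈ graphCell e g K h p) (hp' : y ∈ graphCell e g K h p') : p = p' := by
  have hKh : 0 < 3 * (K * h) :=
    mul_pos three_pos (mul_pos (by exact_mod_cast zero_lt_one.trans_le hK) hh)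
  have key1 : ∀ p, y ∈ graphCell e g K h p → ⌊e y 0 / h⌋ = p.1 := by
    rintro p ⟨h1, h2, -⟩
    exact Int.floor_eq_iff.2 ⟨(le_div_iff₀ hh).2 h1, (div_lt_iff₀ hh).2 h2⟩
  have key2 : ∀ p, y ∈ graphCell e g K h p →
      ⌊(e y 1 - g (p.1 * h)) / (3 * (K * h))⌋₊ = p.2 := by
    rintro p ⟨-, -, -, h4, h5⟩
    have h6 : (e y 1 - g (p.1 * h)) / (3 * (K * h)) < p.2 + 1 := by
      rw [div_lt_iff₀ hKh]
      linarith
    rcases Nat.eq_zero_or_pos p.2 with h0 | h0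
    · rw [h0, Nat.floor_eq_zero]
      simpa [h0] using h6
    · refine (Nat.floor_eq_iff' h0.ne').2 ⟨?_, h6⟩
      rw [le_div_iff₀ hKh]
      linarith [h4.resolve_left h0.ne']
  have h1 : p.1 = p'.1 := (key1 p hp).symm.trans (key1 p' hp')
  refine Prod.ext h1 ?_
  rw [← key2 p hp, ← key2 p' hp', h1]

lemma pairwise_disjoint_graphCell (hK : 1 ≤ K) (hh : 0 < h) :
    Pairwise (Function.onFun Disjoint (graphCell e g K h)) := fun _ _ hne =>
  Set.disjoint_left.2 fun _ hy hy' => hne (eq_of_mem_graphCell hK hh hy hy')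

lemma volume_graphCore (p : ℤ × ℕ) :
    volume (graphCore e g K h p) = ENNReal.ofReal h * ENNReal.ofReal (K * h) := by
  unfold graphCore
  rw [volume_rotated_box]
  congr 2 <;> ring

/-- The cell fits in a box of height `4 K h` and the same width as the core, whose height is `K h`.
-/
lemma volume_graphCell_le (hg : LipschitzWith K g) (hK : 1 ≤ K) (hh : 0 < h) (p : ℤ × ℕ) :
    volume (graphCell e g K h p) ≤ 4 * volume (graphCore e g K h p) := by
  have hsub : graphCell e g K h p ⊆ {y | p.1 * h ≤ e y 0 ∧ e y 0 < (p.1 + 1) * h ∧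
      g (p.1 * h) + (3 * p.2 - 1) * (K * h) ≤ e y 1 ∧
      e y 1 < g (p.1 * h) + 3 * (p.2 + 1) * (K * h)} := fun y hy =>
    ⟨hy.1, hy.2.1, sub_le_of_mem_graphCell hg hK hh hy, hy.2.2.2.2⟩
  refine (measure_mono hsub).trans (le_of_eq ?_)
  rw [volume_rotated_box, volume_graphCore,
    show g (p.1 * h) + 3 * (p.2 + 1) * (K * h) - (g (p.1 * h) + (3 * p.2 - 1) * (K * h)) =
      4 * (K * h) by ring, ENNReal.ofReal_mul (by norm_num),
    show ((p.1 : ℝ) + 1) * h - p.1 * h = h by ring]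
  simp
  ring

/-- Poincaré inequality on a cell. -/
lemma lintegral_graphCell_sq_le (hg : LipschitzWith K g) (hK : 1 ≤ K) (hh : 0 < h) (p : ℤ × ℕ)
    {v : EuclideanSpace ℝ (Fin 2) → ℂ} (hv : ContDiff ℝ 1 v) :
    ∫⁻ x in graphCell e g K h p, ‖v x‖ₑ ^ 2 ≤
      ENNReal.ofReal (800 * K ^ 2 * h ^ 2) *
        (∫⁻ x in graphCell e g K h p, ‖fderiv ℝ v x‖ₑ ^ 2) +
      ENNReal.ofReal (8 / h ^ 2) * ‖∫ y in graphCore e g K h p, v y‖ₑ ^ 2 := by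
  have hK0 : (1 : ℝ) ≤ K := by exact_mod_cast hK
  have hKh : 0 < K * h := mul_pos (by linarith) hh
  have hsub := graphCore_subset_graphCell (e := e) hg hK hh p
  have hvol : volume (graphCore e g K h p) = ENNReal.ofReal (K * h ^ 2) := by
    rw [volume_graphCore, ← ENNReal.ofReal_mul hh.le]
    congr 1
    ring
  have hbd : Bornology.IsBounded (graphCore e g K h p) := by
    refine Metric.isBounded_iff.2 ⟨5 * (K * h), fun x hx y hy => ?_⟩
    rw [dist_comm, dist_eq_norm]
    exact norm_sub_le_of_mem_graphCell hg hK hh (hsub hx) (hsub hy)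
  refine (lintegral_sq_le_of_starShaped (d := 5 * (K * h)) (measurableSet_graphCell hg p)
    (measurableSet_graphCore p) hsub
    (fun x hx y hy θ hθ => add_smul_mem_graphCell hg hK hh hx hy hθ)
    (fun x hx y hy => norm_sub_le_of_mem_graphCell hg hK hh hx (hsub hy)) ?_ ?_
    (volume_graphCell_le hg hK hh p) hbd hv).trans ?_
  · rw [hvol]
    simp only [ne_eq, ENNReal.ofReal_eq_zero, not_le]
    nlinarith
  · rw [hvol]
    exact ENNReal.ofReal_ne_top
  -- The constants are `32 · 5² = 800`, and `8 / (K h²) ≤ 8 / h²` by `K ≥ 1`.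
  · gcongr
    · rw [show (32 : ENNReal) = ENNReal.ofReal 32 by simp, ← ENNReal.ofReal_mul (by norm_num)]
      refine ENNReal.ofReal_le_ofReal (le_of_eq ?_)
      ring
    · rw [hvol, show (8 : ENNReal) = ENNReal.ofReal 8 by simp,
        ← ENNReal.ofReal_inv_of_pos (by positivity), ← ENNReal.ofReal_mul (by norm_num)]
      refine ENNReal.ofReal_le_ofReal ?_
      rw [div_eq_mul_inv]
      gcongr
      nlinarith [sq_nonneg h]

end Cells

/-! ### Poincaré inequalities with `O(h ^ (-2))` averages -/

/-- For small `h`, the `L²`-norm on `U` of a `C¹` function is controlled by `h` times the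
`L²`-norm on `Ω` of its gradient, up to `O(h ^ (-2))` integrals over subsets of `Ω`. -/
def HasPoincareCells (Ω U : Set (EuclideanSpace ℝ (Fin 2))) : Prop :=
  ∃ C δ : ℝ, 0 < C ∧ 0 < δ ∧ ∀ h : ℝ, 0 < h → h ≤ δ →
    ∃ (ι : Type) (_ : Fintype ι) (B : ι → Set (EuclideanSpace ℝ (Fin 2))),
      (Fintype.card ι : ℝ) ≤ C / h ^ 2 ∧ (∀ i, MeasurableSet (B i) ∧ B i ⊆ Ω) ∧
      ∀ v : EuclideanSpace ℝ (Fin 2) → ℂ, ContDiff ℝ 1 v →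
        ∫⁻ x in U, ‖v x‖ₑ ^ 2 ≤
          ENNReal.ofReal (C * h ^ 2) * (∫⁻ x in Ω, ‖fderiv ℝ v x‖ₑ ^ 2) +
          ENNReal.ofReal (C / h ^ 2) * ∑ i, ‖∫ x in B i, v x‖ₑ ^ 2

lemma HasPoincareCells.mono {Ω U U' : Set (EuclideanSpace ℝ (Fin 2))} (hU : U ⊆ U')
    (H : HasPoincareCells Ω U') : HasPoincareCells Ω U := by
  obtain ⟨C, δ, hC, hδ, H⟩ := H
  refine ⟨C, δ, hC, hδ, fun h h0 hle => ?_⟩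
  obtain ⟨ι, _, B, h1, h2, h3⟩ := H h h0 hle
  exact ⟨ι, _, B, h1, h2, fun v hv => (lintegral_mono_set hU).trans (h3 v hv)⟩

lemma HasPoincareCells.empty (Ω : Set (EuclideanSpace ℝ (Fin 2))) : HasPoincareCells Ω ∅ := by
  refine ⟨1, 1, one_pos, one_pos, fun h h0 hle => ⟨Empty, inferInstance, Empty.elim, ?_, ?_, ?_⟩⟩
  · simpa using sq_nonneg h
  · exact fun i => i.elim
  · simp

lemma HasPoincareCells.union {Ω U₁ U₂ : Set (EuclideanSpace ℝ (Fin 2))}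
    (H₁ : HasPoincareCells Ω U₁) (H₂ : HasPoincareCells Ω U₂) :
    HasPoincareCells Ω (U₁ ∪ U₂) := by
  obtain ⟨C₁, δ₁, hC₁, hδ₁, H₁⟩ := H₁
  obtain ⟨C₂, δ₂, hC₂, hδ₂, H₂⟩ := H₂
  refine ⟨C₁ + C₂, min δ₁ δ₂, by positivity, lt_min hδ₁ hδ₂, fun h h0 hle => ?_⟩
  obtain ⟨ι₁, _, B₁, a1, a2, a3⟩ := H₁ h h0 (hle.trans (min_le_left _ _))
  obtain ⟨ι₂, _, B₂, b1, b2, b3⟩ := H₂ h h0 (hle.trans (min_le_right _ _))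
  refine ⟨ι₁ ⊕ ι₂, inferInstance, Sum.elim B₁ B₂, ?_, ?_, fun v hv => ?_⟩
  · rw [Fintype.card_sum, add_div]
    push_cast
    exact add_le_add a1 b1
  · rintro (i | i)
    exacts [a2 i, b2 i]
  · refine (lintegral_union_le _ _ _).trans ((add_le_add (a3 v hv) (b3 v hv)).trans ?_)
    rw [Fintype.sum_sum_type, add_mul, add_div, ENNReal.ofReal_add (by positivity) (by positivity),
      add_mul, mul_add]
    simp only [Sum.elim_inl, Sum.elim_inr]
    rw [add_add_add_comm]
    gcongr
    · exact le_add_of_nonneg_right (by positivity)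
    · exact le_add_of_nonneg_left (by positivity)

/-- Near a point where `Ω` is the region above a Lipschitz graph. -/
lemma hasPoincareCells_of_graph {Ω : Set (EuclideanSpace ℝ (Fin 2))}
    {x : EuclideanSpace ℝ (Fin 2)}
    (e : EuclideanSpace ℝ (Fin 2) ≃ₗᵢ[ℝ] EuclideanSpace ℝ (Fin 2)) {g : ℝ → ℝ} {K : NNReal}
    {r : ℝ} (hg : LipschitzWith K g) (hK : 1 ≤ K) (hr : 0 < r)
    (hΩ : ∀ y ∈ Metric.ball x r, y ∈ Ω ↔ g (e y 0) < e y 1) :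
    HasPoincareCells Ω (Ω ∩ Metric.ball x (r / 2)) := by
  have hK0 : (1 : ℝ) ≤ K := by exact_mod_cast hK
  set A := volume.real (Metric.ball x r) with hA
  have hA0 : 0 ≤ A := measureReal_nonneg
  -- The threshold `r / (10 K)` makes the cell diameter at most `r / 2`, so cells meeting the half
  -- ball stay in the ball; the summand `A` pays for the number of cells.
  refine ⟨800 * K ^ 2 + 8 + A, r / (10 * K), by positivity, by positivity, fun h h0 hle => ?_⟩
  have h5 : 5 * (K * h) ≤ r / 2 := by
    rw [le_div_iff₀ (by positivity)] at hle
    linarith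
  have hKh : 0 < K * h := mul_pos (by linarith) h0
  let Λ : Set (ℤ × ℕ) := {p | (graphCell e g K h p ∩ Metric.ball x (r / 2)).Nonempty}
  have hball : ∀ p : Λ, graphCell e g K h p ⊆ Metric.ball x r := by
    rintro ⟨p, z, hz, hzb⟩ y hy
    rw [Metric.mem_ball] at hzb ⊢
    have h1 := norm_sub_le_of_mem_graphCell hg hK h0 hz hy
    rw [← dist_eq_norm] at h1
    linarith [dist_triangle y z x]
  have hcell : ∀ p : Λ, graphCell e g K h p ⊆ Ω := fun p y hy =>
    (hΩ y (hball p hy)).2 hy.2.2.1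
  have hcore : ∀ p : Λ, graphCore e g K h p ⊆ graphCell e g K h p := fun p =>
    graphCore_subset_graphCell hg hK h0 p
  have hdisj : Pairwise (Function.onFun Disjoint fun p : Λ => graphCell e g K h p) :=
    fun p p' hne => pairwise_disjoint_graphCell hK h0 (Subtype.coe_injective.ne hne)
  have hdisj' : Pairwise (Function.onFun Disjoint fun p : Λ => graphCore e g K h p) :=
    fun p p' hne => (hdisj hne).mono (hcore p) (hcore p')
  have hunion : volume (⋃ p : Λ, graphCore e g K h p) ≤ volume (Metric.ball x r) :=
    measure_mono (Set.iUnion_subset fun p => (hcore p).trans (hball p))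
  have hvol : ∀ p : Λ, volume (graphCore e g K h p) = ENNReal.ofReal (K * h ^ 2) := by
    intro p
    rw [volume_graphCore, ← ENNReal.ofReal_mul h0.le]
    congr 1
    ring
  have hvolpos : 0 < ENNReal.ofReal (K * h ^ 2) := ENNReal.ofReal_pos.2 (by positivity)
  -- The cores are disjoint, of equal positive area, and lie in a ball; the same packing argument
  -- later gives the `O(h⁻²)` count.
  have hfin : Finite Λ := by
    have h1 := Measure.finite_const_le_meas_of_disjoint_iUnion volume hvolpos
      (fun p : Λ => measurableSet_graphCore (e := e) (g := g) (K := K) (h := h) p) hdisj'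
      (hunion.trans_lt Metric.isBounded_ball.measure_lt_top).ne
    refine Set.finite_univ_iff.1 (h1.subset fun p _ => (hvol p).ge)
  let _ : Fintype Λ := Fintype.ofFinite Λ
  refine ⟨Λ, inferInstance, fun p => graphCore e g K h p, ?_,
    fun p => ⟨measurableSet_graphCore _, (hcore p).trans (hcell p)⟩, fun v hv => ?_⟩
  · rw [measure_iUnion hdisj' fun p => measurableSet_graphCore _, tsum_fintype] at hunion
    simp only [hvol, Finset.sum_const, Finset.card_univ, nsmul_eq_mul] at hunion
    have h1 := ENNReal.toReal_mono Metric.isBounded_ball.measure_lt_top.ne hunion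
    rw [ENNReal.toReal_mul, ENNReal.toReal_natCast, ENNReal.toReal_ofReal (by positivity)] at h1
    rw [le_div_iff₀ (by positivity)]
    have h2 : (Fintype.card Λ : ℝ) * h ^ 2 ≤ Fintype.card Λ * (K * h ^ 2) := by
      gcongr
      exact le_mul_of_one_le_left (by positivity) hK0
    have h3 : (Fintype.card Λ : ℝ) * h ^ 2 ≤ A := h2.trans h1
    nlinarith [sq_nonneg (K : ℝ)]
  · have hcover : Ω ∩ Metric.ball x (r / 2) ⊆ ⋃ p : Λ, graphCell e g K h p := by
      rintro y ⟨hy, hyb⟩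
      have hyr : y ∈ Metric.ball x r := Metric.ball_subset_ball (by linarith) hyb
      obtain ⟨p, hp⟩ := exists_mem_graphCell hK h0 ((hΩ y hyr).1 hy)
      exact Set.mem_iUnion.2 ⟨⟨p, y, hp, hyb⟩, hp⟩
    have hsum : ∀ f : EuclideanSpace ℝ (Fin 2) → ENNReal,
        ∫⁻ x in ⋃ p : Λ, graphCell e g K h p, f x =
          ∑ p : Λ, ∫⁻ x in graphCell e g K h p, f x := fun f => by
      rw [lintegral_iUnion (fun p => measurableSet_graphCell hg _) hdisj, tsum_fintype]
    have hsub : ⋃ p : Λ, graphCell e g K h p ⊆ Ω := Set.iUnion_subset hcell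
    calc ∫⁻ x in Ω ∩ Metric.ball x (r / 2), ‖v x‖ₑ ^ 2
        ≤ ∑ p : Λ, ∫⁻ x in graphCell e g K h p, ‖v x‖ₑ ^ 2 :=
          (lintegral_mono_set hcover).trans (hsum _).le
      _ ≤ ∑ p : Λ, (ENNReal.ofReal (800 * K ^ 2 * h ^ 2) *
            (∫⁻ x in graphCell e g K h p, ‖fderiv ℝ v x‖ₑ ^ 2) +
          ENNReal.ofReal (8 / h ^ 2) * ‖∫ y in graphCore e g K h p, v y‖ₑ ^ 2) :=
          Finset.sum_le_sum fun p _ => lintegral_graphCell_sq_le hg hK h0 p hv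
      _ = ENNReal.ofReal (800 * K ^ 2 * h ^ 2) *
            (∫⁻ x in ⋃ p : Λ, graphCell e g K h p, ‖fderiv ℝ v x‖ₑ ^ 2) +
          ENNReal.ofReal (8 / h ^ 2) * ∑ p : Λ, ‖∫ y in graphCore e g K h p, v y‖ₑ ^ 2 := by
          rw [hsum, Finset.sum_add_distrib, Finset.mul_sum, Finset.mul_sum]
      _ ≤ _ := by
          gcongr
          · linarith
          · nlinarith [sq_nonneg (K : ℝ)]

/-- A bounded Lipschitz domain has Poincaré inequalities with `O(h ^ (-2))` averages. -/
lemma HasLipschitzBoundary.hasPoincareCells {Ω : Set (EuclideanSpace ℝ (Fin 2))}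
    (hΩ : IsOpen Ω) (hb : Bornology.IsBounded Ω) (hL : HasLipschitzBoundary Ω) :
    HasPoincareCells Ω Ω := by
  have key : HasPoincareCells Ω (Ω ∩ closure Ω) := by
    refine hb.isCompact_closure.induction_on (p := fun s => HasPoincareCells Ω (Ω ∩ s)) ?_ ?_ ?_ ?_
    · rw [Set.inter_empty]
      exact .empty Ω
    · exact fun s t hst H => H.mono (Set.inter_subset_inter_right Ω hst)
    · intro s t H₁ H₂
      rw [Set.inter_union_distrib_left]
      exact H₁.union H₂
    · intro x hx
      suffices H : ∃ (e : EuclideanSpace ℝ (Fin 2) ≃ₗᵢ[ℝ] EuclideanSpace ℝ (Fin 2)) (g : ℝ → ℝ)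
          (K : NNReal) (r : ℝ), LipschitzWith K g ∧ 0 < r ∧
          ∀ y ∈ Metric.ball x r, y ∈ Ω ↔ g (e y 0) < e y 1 by
        obtain ⟨e, g, K, r, hg, hr, H⟩ := H
        refine ⟨Metric.ball x (r / 2),
          mem_nhdsWithin_of_mem_nhds (Metric.ball_mem_nhds x (half_pos hr)), ?_⟩
        exact hasPoincareCells_of_graph e (hg.weaken (le_max_left K 1)) (le_max_right K 1) hr H
      by_cases hxΩ : x ∈ Ω
      · obtain ⟨r, hr, hball⟩ := Metric.isOpen_iff.1 hΩ x hxΩ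
        -- At an interior point, a horizontal line below the ball serves as the graph.
        refine ⟨LinearIsometryEquiv.refl ℝ _, fun _ => x 1 - r, 0, r, LipschitzWith.const _, hr,
          fun y hy => iff_of_true (hball hy) ?_⟩
        have h1 := PiLp.norm_apply_le (y - x) 1
        rw [Metric.mem_ball, dist_eq_norm] at hy
        rw [PiLp.sub_apply, Real.norm_eq_abs] at h1
        simp only [LinearIsometryEquiv.coe_refl, id_eq]
        linarith [neg_abs_le (y 1 - x 1)]
      · exact hL x (hΩ.frontier_eq ▸ Set.mem_sdiff_of_mem hx hxΩ)
  exact key.mono (Set.subset_inter subset_rfl subset_closure)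

/-! ### Iteration on the Sobolev space -/

lemma contDiff_partialDeriv {j : ℕ} (κ : Fin j → Fin 2) {u : EuclideanSpace ℝ (Fin 2) → ℂ}
    (hu : ContDiff ℝ ∞ u) : ContDiff ℝ 1 (partialDeriv κ u) := by
  have h1 : ContDiff ℝ 1 (iteratedFDeriv ℝ j u) :=
    hu.iteratedFDeriv_right (by exact_mod_cast le_top)
  exact (ContinuousMultilinearMap.apply ℝ (fun _ : Fin j => EuclideanSpace ℝ (Fin 2)) ℂ
    (fun i => EuclideanSpace.single (κ i) (1 : ℝ))).contDiff.comp h1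

lemma fderiv_partialDeriv {j : ℕ} (κ : Fin j → Fin 2) {u : EuclideanSpace ℝ (Fin 2) → ℂ}
    (hu : ContDiff ℝ ∞ u) (i : Fin 2) (x : EuclideanSpace ℝ (Fin 2)) :
    fderiv ℝ (partialDeriv κ u) x (EuclideanSpace.single i 1) =
      partialDeriv (Fin.cons i κ : Fin (j + 1) → Fin 2) u x := by
  have hd : Differentiable ℝ (iteratedFDeriv ℝ j u) :=
    hu.differentiable_iteratedFDeriv (by exact_mod_cast WithTop.coe_lt_top j)
  have h1 : HasFDerivAt (partialDeriv κ u) _ x :=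
    ((ContinuousMultilinearMap.apply ℝ (fun _ : Fin j => EuclideanSpace ℝ (Fin 2)) ℂ
      (fun i => EuclideanSpace.single (κ i) (1 : ℝ))).hasFDerivAt).comp x (hd x).hasFDerivAt
  rw [h1.fderiv]
  rfl

lemma enorm_sq_le_sum_enorm_apply_single_sq (A : EuclideanSpace ℝ (Fin 2) →L[ℝ] ℂ) :
    ‖A‖ₑ ^ 2 ≤ 2 * ∑ i, ‖A (EuclideanSpace.single i 1)‖ₑ ^ 2 := by
  have h1 : ‖A‖ ≤ ∑ i, ‖A (EuclideanSpace.single i 1)‖ := by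
    refine A.opNorm_le_bound (by positivity) fun w => ?_
    have hw : w = ∑ i, w i • EuclideanSpace.single i (1 : ℝ) := by
      ext i
      fin_cases i <;> simp
    have hAw : A w = ∑ i, w i • A (EuclideanSpace.single i (1 : ℝ)) := by
      conv_lhs => rw [hw, map_sum]
      simp
    rw [hAw, Finset.sum_mul]
    refine norm_sum_le_of_le _ fun i _ => ?_
    rw [norm_smul, mul_comm]
    gcongr
    exact PiLp.norm_apply_le w i
  have h2 : ‖A‖ ^ 2 ≤ 2 * ∑ i, ‖A (EuclideanSpace.single i 1)‖ ^ 2 := by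
    have h3 : ‖A‖ ^ 2 ≤ (∑ i, ‖A (EuclideanSpace.single i 1)‖) ^ 2 := by gcongr
    rw [Fin.sum_univ_two] at h3 ⊢
    nlinarith [sq_nonneg (‖A (EuclideanSpace.single 0 1)‖ - ‖A (EuclideanSpace.single 1 1)‖)]
  have h4 := ENNReal.ofReal_le_ofReal h2
  rw [ENNReal.ofReal_mul (by norm_num), ENNReal.ofReal_sum_of_nonneg fun i _ => by positivity] at h4
  simpa only [ENNReal.ofReal_pow (norm_nonneg _), ofReal_norm, ENNReal.ofReal_ofNat] using h4

lemma Lp.enorm_sq_eq_lintegral {α : Type*} [MeasurableSpace α] {μ : Measure α} (f : Lp ℂ 2 μ) :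
    ‖f‖ₑ ^ 2 = ∫⁻ x, ‖f x‖ₑ ^ 2 ∂μ := by
  have h := eLpNorm_nnreal_pow_eq_lintegral (f := f) (μ := μ) (p := 2) two_ne_zero
  rw [Lp.enorm_def]
  simpa using h

/-- The functional `U ↦ ∫_B U_k` on the space of jets. -/
noncomputable def jetIntegral {γ : ℕ} {Ω : Set (EuclideanSpace ℝ (Fin 2))}
    (B : Set (EuclideanSpace ℝ (Fin 2))) (hB : MeasurableSet B)
    (hBt : volume.restrict Ω B ≠ ⊤) (k : JetIndex γ) : JetSpace γ Ω →L[ℂ] ℂ :=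
  (innerSL ℂ (indicatorConstLp 2 hB hBt (1 : ℂ))) ∘L
    PiLp.proj (𝕜 := ℂ) 2 (fun _ : JetIndex γ => Lp ℂ 2 (volume.restrict Ω)) k

lemma jetIntegral_apply {γ : ℕ} {Ω : Set (EuclideanSpace ℝ (Fin 2))}
    (B : Set (EuclideanSpace ℝ (Fin 2))) (hB : MeasurableSet B)
    (hBt : volume.restrict Ω B ≠ ⊤) (k : JetIndex γ) (U : JetSpace γ Ω) :
    jetIntegral B hB hBt k U = ∫ x in B, U k x ∂(volume.restrict Ω) :=
  L2.inner_indicatorConstLp_one (𝕜 := ℂ) hB hBt (U k)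

/-- A Poincaré inequality for smooth functions passes to the components of the elements of the
Sobolev space. -/
lemma enorm_jet_sq_le {γ : ℕ} {Ω : Set (EuclideanSpace ℝ (Fin 2))}
    {ι : Type} [Fintype ι] {B : ι → Set (EuclideanSpace ℝ (Fin 2))}
    (hB : ∀ i, MeasurableSet (B i)) (hBΩ : ∀ i, B i ⊆ Ω)
    (hBt : ∀ i, volume.restrict Ω (B i) ≠ ⊤) {a b : ℝ}
    (H : ∀ v : EuclideanSpace ℝ (Fin 2) → ℂ, ContDiff ℝ 1 v →
      ∫⁻ x in Ω, ‖v x‖ₑ ^ 2 ≤ ENNReal.ofReal a * (∫⁻ x in Ω, ‖fderiv ℝ v x‖ₑ ^ 2) +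
        ENNReal.ofReal b * ∑ i, ‖∫ x in B i, v x‖ₑ ^ 2)
    (U : SobolevSpace γ Ω) {j : ℕ} (hj : j + 1 < γ + 1) (κ : Fin j → Fin 2) :
    ‖(U : JetSpace γ Ω) ⟨⟨j, (Nat.lt_succ_self j).trans hj⟩, κ⟩‖ₑ ^ 2 ≤
      ENNReal.ofReal a * (2 * ∑ i : Fin 2,
        ‖(U : JetSpace γ Ω) ⟨⟨j + 1, hj⟩, (Fin.cons i κ : Fin (j + 1) → Fin 2)⟩‖ₑ ^ 2) +
      ENNReal.ofReal b * ∑ i, ‖jetIntegral (B i) (hB i) (hBt i)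
        ⟨⟨j, (Nat.lt_succ_self j).trans hj⟩, κ⟩ (U : JetSpace γ Ω)‖ₑ ^ 2 := by
  have hcont : ∀ L : JetSpace γ Ω →L[ℂ] ℂ, Continuous fun V : JetSpace γ Ω => ‖L V‖ₑ ^ 2 :=
    fun L => (ENNReal.continuous_pow 2).comp L.continuous.enorm
  have hcont' : ∀ k : JetIndex γ, Continuous fun V : JetSpace γ Ω => ‖V k‖ₑ ^ 2 := fun k =>
    (ENNReal.continuous_pow 2).comp (PiLp.continuous_apply 2 _ k).enorm
  have hcl : IsClosed {V : JetSpace γ Ω |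
      ‖V ⟨⟨j, (Nat.lt_succ_self j).trans hj⟩, κ⟩‖ₑ ^ 2 ≤
      ENNReal.ofReal a * (2 * ∑ i : Fin 2,
        ‖V ⟨⟨j + 1, hj⟩, (Fin.cons i κ : Fin (j + 1) → Fin 2)⟩‖ₑ ^ 2) +
      ENNReal.ofReal b * ∑ i, ‖jetIntegral (B i) (hB i) (hBt i)
        ⟨⟨j, (Nat.lt_succ_self j).trans hj⟩, κ⟩ V‖ₑ ^ 2} := by
    refine isClosed_le (hcont' _) (Continuous.fun_add ?_ ?_)
    · refine (ENNReal.continuous_const_mul ENNReal.ofReal_ne_top).comp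
        ((ENNReal.continuous_const_mul (by simp)).comp ?_)
      exact continuous_finsetSum _ fun i _ => hcont' _
    · refine (ENNReal.continuous_const_mul ENNReal.ofReal_ne_top).comp ?_
      exact continuous_finsetSum _ fun i _ => hcont _
  refine closure_minimal (s := (smoothJets γ Ω : Set (JetSpace γ Ω))) ?_ hcl U.2
  rintro V ⟨u, hu, hV⟩
  have hnorm : ∀ k : JetIndex γ,
      ‖V k‖ₑ ^ 2 = ∫⁻ x in Ω, ‖partialDeriv k.2 u x‖ₑ ^ 2 := by
    intro k
    rw [Lp.enorm_sq_eq_lintegral]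
    refine lintegral_congr_ae ?_
    filter_upwards [hV k] with x hx
    rw [hx]
  have hint : ∀ (i : ι) (k : JetIndex γ), jetIntegral (B i) (hB i) (hBt i) k V =
      ∫ x in B i, partialDeriv k.2 u x := by
    intro i k
    rw [jetIntegral_apply, integral_congr_ae (ae_restrict_of_ae (hV k)),
      Measure.restrict_restrict (hB i), Set.inter_eq_left.2 (hBΩ i)]
  simp only [Set.mem_ofPred_eq, hnorm, hint]
  refine (H _ (contDiff_partialDeriv κ hu)).trans ?_
  gcongr
  have hm : ∀ i : Fin 2, Measurable fun x =>
      ‖partialDeriv (Fin.cons i κ : Fin (j + 1) → Fin 2) u x‖ₑ ^ 2 := fun i =>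
    (contDiff_partialDeriv _ hu).continuous.enorm.measurable.pow_const 2
  rw [← lintegral_finsetSum _ fun i _ => hm i, ← lintegral_const_mul' _ _ (by simp)]
  refine lintegral_mono fun x => ?_
  simp only [← fderiv_partialDeriv κ hu]
  exact enorm_sq_le_sum_enorm_apply_single_sq _

/-- If all integrals vanish, the Poincaré inequality can be iterated. -/
lemma norm_jet_zero_sq_le {γ : ℕ} {Ω : Set (EuclideanSpace ℝ (Fin 2))} {a : ℝ} (ha : 0 ≤ a)
    (U : JetSpace γ Ω)
    (H : ∀ {j : ℕ} (hj : j + 1 < γ + 1) (κ : Fin j → Fin 2),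
      ‖U ⟨⟨j, (Nat.lt_succ_self j).trans hj⟩, κ⟩‖ ^ 2 ≤
        a * ∑ i : Fin 2, ‖U ⟨⟨j + 1, hj⟩, (Fin.cons i κ : Fin (j + 1) → Fin 2)⟩‖ ^ 2) :
    ‖U ⟨0, fun _ => 0⟩‖ ^ 2 ≤ a ^ γ * ‖U‖ ^ 2 := by
  have key : ∀ (j : ℕ) (hj : j < γ + 1), ‖U ⟨0, fun _ => 0⟩‖ ^ 2 ≤
      a ^ j * ∑ κ : Fin j → Fin 2, ‖U ⟨⟨j, hj⟩, κ⟩‖ ^ 2 := by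
    intro j
    induction j with
    | zero =>
      intro hj
      rw [Fintype.sum_unique, pow_zero, one_mul]
      exact (congrArg (fun κ : Fin 0 → Fin 2 => ‖U ⟨⟨0, hj⟩, κ⟩‖ ^ 2)
        (Subsingleton.elim _ fun _ => 0)).ge
    | succ j ih =>
      intro hj
      refine (ih ((Nat.lt_succ_self j).trans hj)).trans ?_
      rw [pow_succ, mul_assoc]
      gcongr
      refine (Finset.sum_le_sum fun κ _ => H hj κ).trans (le_of_eq ?_)
      -- Prepending `i` to `κ` enumerates the multi-indices of length `j + 1` exactly once.
      rw [← Finset.mul_sum, Finset.sum_comm, ← Fintype.sum_prod_type']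
      congr 1
      exact Fintype.sum_equiv (Fin.consEquiv fun _ => Fin 2) _ _ fun p => rfl
  refine (key γ (Nat.lt_succ_self γ)).trans ?_
  gcongr
  rw [PiLp.norm_sq_eq_of_L2, Fintype.sum_sigma]
  exact Finset.single_le_sum (f := fun j : Fin (γ + 1) =>
    ∑ κ : Fin (j : ℕ) → Fin 2, ‖U ⟨j, κ⟩‖ ^ 2) (fun j _ => by positivity)
    (Finset.mem_univ (⟨γ, Nat.lt_succ_self γ⟩ : Fin (γ + 1)))

theorem mainTheorem9 (γ : ℕ) (hγ : 1 ≤ γ) (Ω : Set (EuclideanSpace ℝ (Fin 2)))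
    (hΩ : IsOpen Ω) (hb : Bornology.IsBounded Ω) (hL : HasLipschitzBoundary Ω)
    (q : ℝ) (hq : 2 / (γ : ℝ) < q) :
    IsSchattenClass q (sobolevEmbedding γ Ω) := by
  obtain ⟨C, δ, hC, hδ, H⟩ := hL.hasPoincareCells hΩ hb
  obtain ⟨J, hJ⟩ : ∃ J : ℝ, J = (Fintype.card (JetIndex γ) : ℝ) := ⟨_, rfl⟩
  have hJ0 : 0 ≤ J := hJ ▸ Nat.cast_nonneg _
  -- The summand `C * J` covers the count of integrals over all jet components. The summands `2 * C
  -- + 1` ensure that the square of the constant is at least `2 * C`, the factor in each Poincaré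
  -- step.
  refine isSchattenClass_of_functionals (sobolevEmbedding γ Ω) hγ hq
    (C := 2 * C + 1 + C * J) (δ := δ) (by positivity) hδ fun h h0 hle => ?_
  obtain ⟨ι, _, B, hcard, hB, hP⟩ := H h h0 hle
  have hBt : ∀ i, volume.restrict Ω (B i) ≠ ⊤ := fun i =>
    ((Measure.restrict_apply_le Ω (B i)).trans_lt
      ((hb.subset (hB i).2).measure_lt_top)).ne
  refine ⟨ι × JetIndex γ, inferInstance, fun p =>
    jetIntegral (B p.1) (hB p.1).1 (hBt p.1) p.2 ∘L (smoothJets γ Ω).topologicalClosure.subtypeL,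
    ?_, fun U hU => ?_⟩
  · rw [Fintype.card_prod, Nat.cast_mul, ← hJ]
    calc (Fintype.card ι : ℝ) * J ≤ C / h ^ 2 * J := by gcongr
      _ = C * J / h ^ 2 := by ring
      _ ≤ (2 * C + 1 + C * J) / h ^ 2 := by
        gcongr
        linarith
  · have hstep : ∀ {j : ℕ} (hj : j + 1 < γ + 1) (κ : Fin j → Fin 2),
        ‖(U : JetSpace γ Ω) ⟨⟨j, (Nat.lt_succ_self j).trans hj⟩, κ⟩‖ ^ 2 ≤
          2 * C * h ^ 2 * ∑ i : Fin 2,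
            ‖(U : JetSpace γ Ω) ⟨⟨j + 1, hj⟩, (Fin.cons i κ : Fin (j + 1) → Fin 2)⟩‖ ^ 2 := by
      intro j hj κ
      have h1 := enorm_jet_sq_le (fun i => (hB i).1) (fun i => (hB i).2) hBt hP U hj κ
      have h2 : ∀ i, jetIntegral (B i) (hB i).1 (hBt i)
          ⟨⟨j, (Nat.lt_succ_self j).trans hj⟩, κ⟩ (U : JetSpace γ Ω) = 0 := fun i =>
        hU (i, ⟨⟨j, (Nat.lt_succ_self j).trans hj⟩, κ⟩)
      simp only [h2, enorm_zero, ne_eq, OfNat.ofNat_ne_zero, not_false_eq_true, zero_pow,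
        Finset.sum_const_zero, mul_zero, add_zero] at h1
      simp only [← ofReal_norm, ← ENNReal.ofReal_pow (norm_nonneg _)] at h1
      rw [← ENNReal.ofReal_sum_of_nonneg fun i _ => by positivity,
        show ∀ t : ENNReal, 2 * t = ENNReal.ofReal 2 * t by simp,
        ← ENNReal.ofReal_mul (by norm_num), ← ENNReal.ofReal_mul (by positivity),
        ENNReal.ofReal_le_ofReal_iff (by positivity)] at h1
      linarith
    have h3 := norm_jet_zero_sq_le (by positivity) (U : JetSpace γ Ω) hstep
    change ‖(U : JetSpace γ Ω) ⟨0, fun _ => 0⟩‖ ≤ _ * ‖(U : JetSpace γ Ω)‖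
    refine le_of_sq_le_sq (h3.trans ?_) (by positivity)
    rw [mul_pow (_ ^ γ), pow_right_comm _ γ 2, mul_pow _ h]
    gcongr
    have : 0 ≤ C * J := by positivity
    nlinarith
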